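/- **Setting.** Let $\{e_j\}_{j\ge 1}$ be the canonical basis of $l^2(\mathbb N)$ and let $P_n$ be the orthogonal projection onto $\mathrm{span}\{e_1,\dots,e_n\}$. Consider closed densely defined operators $T$ on $l^2(\mathbb N)$ such that $\mathrm{span}\{e_j:j\in\mathbb N\}$ is a core of both $T$ and $T^*$, and such that $T$ is normal, i.e. $\mathcal D(T)=\mathcal D(T^*)$ and $\|Tv\|=\|T^*v\|$ for all $v\in\mathcal D(T)$. Let $\sigma(T)$ be the spectrum and $R(z,T)=(T-zI)^{-1}$ for $z\notin\sigma(T)$. Let $\alpha=\{\alpha_n\}$, $\beta=\{\beta_n\}$ be sequences of non-negative real numbers converging to $0$, and let $f:\mathbb N\to\mathbb N$ with $f(n)>n$. Let $S_{f,\alpha,\beta}$ be the set of all $(T,x,z)$ with $T$ as above, $x\in l^2(\mathbb N)$, $z\in\mathbb C\setminus\sigma(T)$, $$\|(P_{f(n)}-I)TP_n\|=O(\alpha_n),\qquad \|P_nx-x\|=O(\beta_n)\qquad(n\to\infty),$$ where the implied constants may depend on $T$ and $x$. An arithmetic algorithm is a program, for a random access (Blum–Shub–Smale type) machine over $\mathbb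 R$ whose only constants are natural numbers, which halts after finitely many arithmetic operations $+,-,\times,\div$ and comparisons, and which queries its data through an oracle. (Complex numbers are given by their real and imaginary parts.) **Theorem.** There exist maps $\Gamma_n:S_{f,\alpha,\beta}\to l^2(\mathbb N)$, $n\in\mathbb N$, all computed by one arithmetic algorithm which takes $n$ as input and which can query the numbers $\langle Te_j,e_i\rangle$, $\langle x,e_i\rangle$ $(i,j\in\mathbb N)$, the number $z$ and the function $f$ (the program itself does not depend on $f,\alpha,\beta$), such that for every $(T,x,z)\in S_{f,\alpha,\beta}$: 1. each $\Gamma_n(T,x,z)$ has finite support with respect to the canonical basis, and $\lim_{n\to\infty}\Gamma_n(T,x,z)=R(z,T)x$ in $l^2(\mathbb N)$; 2. if $C_1,C_2\ge 0$, then for every $n$ with $\|(I-P_{f(n)})TP_n\|\le C_1\alpha_n$ and $\|P_{f(n)}x-x\|\le C_2\beta_{f(n)}$ (hence for all $n$, if $\|(I-P_{f(m)})TP_m\|\le C_1\alpha_m$ and $\|P_mx-x\|\le C_2\beta_m$ for all $m$), $$\|\Gamma_n(T,x,z)-R(z,T)x\|\le\frac{E_n}{\mathrm{dist}(z,\sigma(T))},$$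 where $$E_n:=C_2\beta_{f(n)}+C_1\alpha_n\|\Gamma_n(T,x,z)\|+\|P_{f(n)}(T-zI)\Gamma_n(T,x,z)-P_{f(n)}x\|;$$ 3. the error bound can be computed to arbitrary accuracy once such constants $C_1,C_2$ and the distance, or a positive lower bound for it, are known: there is an arithmetic algorithm (one program for all $f,\alpha,\beta$ and all $(T,x,z)$) which, on input $n$ and $k$, and with access to the data above, to $\alpha$, $\beta$, and to real numbers $C_1,C_2\ge0$ and $d>0$, halts with a real number $b$ such that $|b-E_n/d|\le 2^{-k}$. (Taking $d=1$ gives $E_n$ itself, taking $d=\mathrm{dist}(z,\sigma(T))$ gives the bound in 2.) -/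

import Mathlib

open Filter Topology Asymptotics
open scoped LinearPMap

namespace ResolventSCI

noncomputable section

/-! ### Closed operators on `ℓ²(ℕ)` and their resolvents -/

/-- The Hilbert space `l²(ℕ)` of square summable complex sequences. -/
abbrev Hsp : Type := lp (fun _ : ℕ => ℂ) 2

/-- The canonical basis. It is indexed from `0`, so `e 0, …, e (n - 1)` are the first `n` vectors. -/
def e (j : ℕ) : Hsp := lp.single 2 j (1 : ℂ)

/-- The linear span of the canonical basis (the finitely supported vectors). -/
def finSpan : Submodule ℂ Hsp := Submodule.span ℂ (Set.range e)

/-- `P n` is the orthogonal projection onto the span of the first `n` basis vectors,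
`P n x = ∑_{j < n} ⟨x, e_j⟩ e_j` (Mathlib's inner product is linear in the second slot). -/
def P (n : ℕ) : Hsp →L[ℂ] Hsp :=
  ∑ j ∈ Finset.range n, (innerSL ℂ (e j)).smulRight (e j)

open Classical in
/-- The value `T v` for `v` in the domain of `T` (and `0` for other `v`). -/
def app (T : Hsp →ₗ.[ℂ] Hsp) (v : Hsp) : Hsp :=
  if h : v ∈ T.domain then T ⟨v, h⟩ else 0

/-- The finite rank operator `T P_n`, i.e. `x ↦ ∑_{j < n} ⟨x, e_j⟩ T e_j`
(see `truncation_apply`). -/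
def truncation (T : Hsp →ₗ.[ℂ] Hsp) (n : ℕ) : Hsp →L[ℂ] Hsp :=
  ∑ j ∈ Finset.range n, (innerSL ℂ (e j)).smulRight (app T (e j))

/-- Closed densely defined operators for which the span of the canonical basis
is a core of both `T` and `T*`. -/
structure IsAdmissible (T : Hsp →ₗ.[ℂ] Hsp) : Prop where
  closed : T.IsClosed
  dense : Dense (T.domain : Set Hsp)
  core : T.HasCore finSpan
  core_adjoint : T†.HasCore finSpan

/-- The class of normal operators: admissible operators with `D(T) = D(T*)` and
`‖T x‖ = ‖T* x‖` on the common domain. -/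
structure IsNormalOp (T : Hsp →ₗ.[ℂ] Hsp) : Prop extends IsAdmissible T where
  domain_eq : T.domain = T†.domain
  norm_eq : ∀ v ∈ T.domain, ‖app T v‖ = ‖app T† v‖

/-- The bounded operator `R` is a two-sided inverse of `T - z I : D(T) → l²(ℕ)`. -/
def IsResolventAt (T : Hsp →ₗ.[ℂ] Hsp) (z : ℂ) (R : Hsp →L[ℂ] Hsp) : Prop :=
  (∀ x : Hsp, ∃ h : R x ∈ T.domain, T ⟨R x, h⟩ - z • R x = x) ∧
    ∀ y : T.domain, R (T y - z • (y : Hsp)) = y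

/-- The spectrum `σ(T)`: all `z` for which `T - z I` has no bounded inverse. -/
def specT (T : Hsp →ₗ.[ℂ] Hsp) : Set ℂ := {z | ¬ ∃ R, IsResolventAt T z R}

open Classical in
/-- The resolvent `R(z,T) = (T - z I)⁻¹`, for `z ∉ σ(T)`. -/
def resolv (z : ℂ) (T : Hsp →ₗ.[ℂ] Hsp) : Hsp →L[ℂ] Hsp :=
  if h : ∃ R, IsResolventAt T z R then h.choose else 0

/-- The class of pairs `(T, x)`, `T` normal, with
`‖(P_{f(n)} - I) T P_n‖ = O(α_n)` and `‖P_n x - x‖ = O(β_n)` as `n → ∞`. -/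
def decayClass (f : ℕ → ℕ) (α β : ℕ → ℝ) : Set ((Hsp →ₗ.[ℂ] Hsp) × Hsp) :=
  {A | IsNormalOp A.1 ∧
    (fun n => ‖(P (f n) - 1) ∘L truncation A.1 n‖) =O[atTop] α ∧
    (fun n => ‖P n A.2 - A.2‖) =O[atTop] β}

/-- The numerator `C₂ β_{f(n)} + C₁ α_n ‖y‖ + ‖P_{f(n)} (T - z I) y - P_{f(n)} x‖`
of the a posteriori error bound for an approximation `y ∈ D(T)` of `R(z,T) x`. -/
def errNumerator (f : ℕ → ℕ) (α β : ℕ → ℝ) (T : Hsp →ₗ.[ℂ] Hsp) (x : Hsp) (z : ℂ)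
    (C₁ C₂ : ℝ) (n : ℕ) (y : Hsp) : ℝ :=
  C₂ * β (f n) + C₁ * α n * ‖y‖ + ‖P (f n) (app T y - z • y) - P (f n) x‖

/-! ### Arithmetic algorithms

A random access machine over `ℝ` (a Blum–Shub–Smale machine with oracle), presented as a language
of WHILE programs. It has index registers holding natural numbers and an infinite memory of real
cells addressed by natural numbers. Its only constants are natural numbers, and it may only apply
`+, -, *, /` and comparisons to real numbers, so that on rational data all its computations are
rational. Complex numbers are handled through their real and imaginary parts. -/

/-- The information available to a program: a function `ℕ → ℕ` and, for each kind of query in `Q`,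
a doubly indexed family of real numbers. -/
structure Oracle (Q : Type) where
  index : ℕ → ℕ
  value : Q → ℕ → ℕ → ℝ

/-- Memory contents: index registers and real cells. -/
structure Store where
  var : ℕ → ℕ
  mem : ℕ → ℝ

/-- Expressions for natural numbers. `ask a` queries the function `ℕ → ℕ` of the oracle. -/
inductive NatExp : Type
  | const (k : ℕ)
  | var (v : ℕ)
  | add (a b : NatExp)
  | sub (a b : NatExp)
  | mul (a b : NatExp)
  | div (a b : NatExp)
  | mod (a b : NatExp)
  | ask (a : NatExp)

/-- Expressions for real numbers. `cell a` reads the memory cell with address `a`,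
and `query q a b` reads the entry `(a, b)` of the family `q` of the oracle. -/
inductive RealExp (Q : Type) : Type
  | ofNat (a : NatExp)
  | cell (a : NatExp)
  | query (q : Q) (a b : NatExp)
  | add (r s : RealExp Q)
  | sub (r s : RealExp Q)
  | mul (r s : RealExp Q)

/-- Comparisons and their boolean combinations. -/
inductive Test (Q : Type) : Type
  | natLt (a b : NatExp)
  | realLt (r s : RealExp Q)
  | neg (t : Test Q)
  | conj (t u : Test Q)

/-- Programs. `setDiv a r s` stores the quotient `r / s` in the cell with address `a`. -/
inductive Prog (Q : Type) : Type
  | skip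
  | setVar (v : ℕ) (a : NatExp)
  | setCell (a : NatExp) (r : RealExp Q)
  | setDiv (a : NatExp) (r s : RealExp Q)
  | seq (p q : Prog Q)
  | branch (t : Test Q) (p q : Prog Q)
  | loop (t : Test Q) (p : Prog Q)

/-- Value of an index expression (subtraction is truncated and division rounds down, as in `ℕ`). -/
def NatExp.eval {Q : Type} (O : Oracle Q) (s : Store) : NatExp → ℕ
  | .const k => k
  | .var v => s.var v
  | .add a b => a.eval O s + b.eval O s
  | .sub a b => a.eval O s - b.eval O s
  | .mul a b => a.eval O s * b.eval O s
  | .div a b => a.eval O s / b.eval O s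
  | .mod a b => a.eval O s % b.eval O s
  | .ask a => O.index (a.eval O s)

/-- Value of a real expression. -/
def RealExp.eval {Q : Type} (O : Oracle Q) (s : Store) : RealExp Q → ℝ
  | .ofNat a => (a.eval O s : ℝ)
  | .cell a => s.mem (a.eval O s)
  | .query q a b => O.value q (a.eval O s) (b.eval O s)
  | .add r t => r.eval O s + t.eval O s
  | .sub r t => r.eval O s - t.eval O s
  | .mul r t => r.eval O s * t.eval O s

/-- Truth of a test. -/
def Test.holds {Q : Type} (O : Oracle Q) (s : Store) : Test Q → Prop
  | .natLt a b => a.eval O s < b.eval O s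
  | .realLt r t => r.eval O s < t.eval O s
  | .neg t => ¬ t.holds O s
  | .conj t u => t.holds O s ∧ u.holds O s

/-- `Exec O p s s'`: started in the store `s` with oracle `O`, the program `p` halts, after finitely
many operations, with the store `s'`. There is no rule for a division by zero (the machine is then
stuck) nor for an infinite loop. -/
inductive Exec {Q : Type} (O : Oracle Q) : Prog Q → Store → Store → Prop
  | skip (s : Store) : Exec O .skip s s
  | setVar (v : ℕ) (a : NatExp) (s : Store) :
      Exec O (.setVar v a) s ⟨Function.update s.var v (a.eval O s), s.mem⟩
  | setCell (a : NatExp) (r : RealExp Q) (s : Store) :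
      Exec O (.setCell a r) s ⟨s.var, Function.update s.mem (a.eval O s) (r.eval O s)⟩
  | setDiv (a : NatExp) (r t : RealExp Q) (s : Store) (h : t.eval O s ≠ 0) :
      Exec O (.setDiv a r t) s
        ⟨s.var, Function.update s.mem (a.eval O s) (r.eval O s / t.eval O s)⟩
  | seq {p q : Prog Q} {s₁ s₂ s₃ : Store} (hp : Exec O p s₁ s₂) (hq : Exec O q s₂ s₃) :
      Exec O (.seq p q) s₁ s₃
  | branchTrue {t : Test Q} {p q : Prog Q} {s s' : Store} (ht : t.holds O s)
      (hp : Exec O p s s') : Exec O (.branch t p q) s s'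
  | branchFalse {t : Test Q} {p q : Prog Q} {s s' : Store} (ht : ¬ t.holds O s)
      (hq : Exec O q s s') : Exec O (.branch t p q) s s'
  | loopStop {t : Test Q} {p : Prog Q} {s : Store} (ht : ¬ t.holds O s) :
      Exec O (.loop t p) s s
  | loopStep {t : Test Q} {p : Prog Q} {s₁ s₂ s₃ : Store} (ht : t.holds O s₁)
      (hp : Exec O p s₁ s₂) (hl : Exec O (.loop t p) s₂ s₃) : Exec O (.loop t p) s₁ s₃

/-- The initial store for the input `(n, k)`: the index registers `0` and `1` hold `n` and `k`,
everything else is `0`. -/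
def initStore (n k : ℕ) : Store :=
  ⟨fun v => if v = 0 then n else if v = 1 then k else 0, fun _ => 0⟩

/-- The finite string of complex numbers that a halting program leaves in its memory, as a vector
of `l²(ℕ)`: register `0` holds its length, and the cells `2 i` and `2 i + 1` hold the real and
imaginary parts of the coefficient of `e i`. -/
def outVector (s : Store) : Hsp :=
  ∑ i ∈ Finset.range (s.var 0), (⟨s.mem (2 * i), s.mem (2 * i + 1)⟩ : ℂ) • e i

/-- On input `n`, the program halts with output the vector `y`. -/
def ComputesVector {Q : Type} (p : Prog Q) (O : Oracle Q) (n : ℕ) (y : Hsp) : Prop :=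
  ∃ s, Exec O p (initStore n 0) s ∧ outVector s = y

/-- On input `(n, k)`, the program halts with output the real number `b` (in cell `0`). -/
def ComputesReal {Q : Type} (p : Prog Q) (O : Oracle Q) (n k : ℕ) (b : ℝ) : Prop :=
  ∃ s, Exec O p (initStore n k) s ∧ s.mem 0 = b

/-- Kinds of evaluations of `(T, x, z)`: real and imaginary parts of the matrix entries of `T`,
of the coefficients of `x`, and of `z`. -/
inductive EntryQuery : Type
  | reT | imT | reX | imX | reZ | imZ

/-- The evaluations themselves: `⟨T e_j, e_i⟩`, `⟨x, e_i⟩` (linear in the first slot) and `z`. -/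
def entryValue (T : Hsp →ₗ.[ℂ] Hsp) (x : Hsp) (z : ℂ) : EntryQuery → ℕ → ℕ → ℝ
  | .reT, i, j => (inner ℂ (e i) (app T (e j))).re
  | .imT, i, j => (inner ℂ (e i) (app T (e j))).im
  | .reX, i, _ => (inner ℂ (e i) x).re
  | .imX, i, _ => (inner ℂ (e i) x).im
  | .reZ, _, _ => z.re
  | .imZ, _, _ => z.im

/-- The information from which the resolvent is computed: matrix entries of `T`,
coefficients of `x`, the point `z`, and the function `f`. -/
def entryOracle (f : ℕ → ℕ) (T : Hsp →ₗ.[ℂ] Hsp) (x : Hsp) (z : ℂ) : Oracle EntryQuery :=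
  ⟨f, entryValue T x z⟩

/-- Kinds of evaluations available for the error bound: those of `(T, x, z)`, the terms of the two
null sequences, the two constants, and a positive number `d` standing for the distance. -/
inductive BoundQuery : Type
  | entry (q : EntryQuery)
  | alpha | beta | const₁ | const₂ | dist

/-- The information from which the error bound is computed. -/
def boundOracle (f : ℕ → ℕ) (α β : ℕ → ℝ) (T : Hsp →ₗ.[ℂ] Hsp) (x : Hsp) (z : ℂ)
    (C₁ C₂ d : ℝ) : Oracle BoundQuery where
  index := f
  value q i j :=
    match q with
    | .entry q => entryValue T x z q i j
    | .alpha => α i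
    | .beta => β i
    | .const₁ => C₁
    | .const₂ => C₂
    | .dist => d

/-! ### Consistency of the definitions -/

theorem e_mem {T : Hsp →ₗ.[ℂ] Hsp} (hT : IsAdmissible T) (j : ℕ) : e j ∈ T.domain :=
  hT.core.le_domain (Submodule.subset_span ⟨j, rfl⟩)

theorem P_mem {T : Hsp →ₗ.[ℂ] Hsp} (hT : IsAdmissible T) (n : ℕ) (x : Hsp) :
    P n x ∈ T.domain := by
  have h : P n x = ∑ j ∈ Finset.range n, (innerSL ℂ (e j) x) • e j := by simp [P]
  rw [h]
  exact Submodule.sum_mem _ fun j _ => Submodule.smul_mem _ _ (e_mem hT j)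

theorem P_coord (n : ℕ) (x : Hsp) (i : ℕ) :
    (P n x : ℕ → ℂ) i = if i < n then (x : ℕ → ℂ) i else 0 := by
  have h : ∀ (j : ℕ) (v : Hsp), inner ℂ (e j) v = (v : ℕ → ℂ) j := fun j v => by
    simp [e, lp.inner_single_left]
  have he : ∀ j, (e j : ℕ → ℂ) i = if i = j then 1 else 0 := fun j => by
    simp [e, Pi.single_apply]
  have hP : P n x = ∑ j ∈ Finset.range n, (x : ℕ → ℂ) j • e j := by simp [P, h]
  rw [← h i, hP, inner_sum]
  simp only [inner_smul_right]
  simp [h, he]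

theorem truncation_apply {T : Hsp →ₗ.[ℂ] Hsp} (hT : IsAdmissible T) (n : ℕ) (x : Hsp) :
    truncation T n x = T ⟨P n x, P_mem hT n x⟩ := by
  have h : (⟨P n x, P_mem hT n x⟩ : T.domain) =
      ∑ j ∈ Finset.range n, (innerSL ℂ (e j) x) • (⟨e j, e_mem hT j⟩ : T.domain) := by
    apply Subtype.ext
    simp [P]
  rw [h, ← LinearPMap.toFun_eq_coe, map_sum]
  simp only [map_smul]
  simp [truncation, app, e_mem hT]

theorem resolv_spec {T : Hsp →ₗ.[ℂ] Hsp} {z : ℂ} (hz : z ∉ specT T) :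
    IsResolventAt T z (resolv z T) := by
  have h : ∃ R, IsResolventAt T z R := by simpa [specT] using hz
  rw [resolv, dif_pos h]
  exact h.choose_spec

/-- The machine is deterministic. -/
theorem Exec.det {Q : Type} {O : Oracle Q} {p : Prog Q} {s s₁ s₂ : Store}
    (h₁ : Exec O p s s₁) (h₂ : Exec O p s s₂) : s₁ = s₂ := by
  induction h₁ generalizing s₂ with
  | seq _ _ ih₁ ih₂ => cases h₂ with | seq a b => exact ih₂ (ih₁ a ▸ b)
  | branchTrue ht _ ih => cases h₂ with
    | branchTrue _ a => exact ih a
    | branchFalse h _ => exact absurd ht h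
  | branchFalse ht _ ih => cases h₂ with
    | branchTrue h _ => exact absurd h ht
    | branchFalse _ a => exact ih a
  | loopStop ht => cases h₂ with
    | loopStop _ => rfl
    | loopStep h _ _ => exact absurd h ht
  | loopStep ht _ _ ih₁ ih₂ => cases h₂ with
    | loopStop h => exact absurd ht h
    | loopStep _ a b => exact ih₂ (ih₁ a ▸ b)
  | _ => cases h₂; rfl

end

end ResolventSCI

open ResolventSCI

/-!
The algorithm is an exhaustive search. At stage `n` it runs through the `(n + 1)² + 1` vectors of
`ℚ[i]ⁿ` coded by the numbers `m ≤ (n + 1)²`, computes for each of them the squared residual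
`‖P_{f(n)} (T - z) y - P_{f(n)} x‖²`, which is a finite sum of products of queried numbers, and
returns the first vector `y` for which it is smallest.

The finitely supported vectors are a core of `T`, and finitely supported vectors with rational
coefficients approximate them, so some fixed rational vector has `‖(T - z) y - x‖ < ε`. Gödel's
`β`-function codes it, from some stage on, by an `m ≤ (n + 1)²`
(`IsAdmissible.exists_candidate_lt`), and `P_{f(n)}` does not increase norms. Hence the smallest
residuals tend to zero (`tendsto_residual_bestCode`). As
`y - R(z,T) x = R(z,T) ((T - z) y - x)`, and as `(1 - P_{f(n)}) (T - z) y = (1 - P_{f(n)}) T P_n y`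
for `y` in the range of `P_n`, the error is controlled by the residual
(`IsAdmissible.norm_sub_resolvent_le`), which gives convergence (`tendsto_of_residual`).

The constant in the error bound comes from `‖R(z,T)‖ ≤ 1 / dist(z, σ(T))`
(`IsNormalOp.norm_resolvent_le`). The resolvent of a normal operator is a bounded normal operator,
so its norm is its spectral radius, and `1 + (z - l) R(z,T)` is invertible exactly if `l ∉ σ(T)`.

The bound itself involves the norms of the candidate and of its residual, whose squares are computed
exactly. Their square roots are found up to `1 / N` by searching for `⌊N √A⌋`, with `N` so large that
the final error is at most `2⁻ᵏ` (`computesReal_boundProg`). Programs are verified with a total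
correctness calculus for the big-step semantics: `Wp` and the rules for its loops.
-/

namespace ResolventSCI

/-! ### Coordinates and truncations -/

theorem app_of_mem {T : Hsp →ₗ.[ℂ] Hsp} {v : Hsp} (h : v ∈ T.domain) : app T v = T ⟨v, h⟩ :=
  dif_pos h

theorem inner_e (j : ℕ) (v : Hsp) : inner ℂ (e j) v = (v : ℕ → ℂ) j := by
  simp [e, lp.inner_single_left]

theorem orthonormal_e : Orthonormal ℂ e := by
  rw [orthonormal_iff_ite]
  intro i j
  rw [inner_e, e, lp.single_apply]
  simp [Pi.single_apply]

theorem P_apply (n : ℕ) (x : Hsp) : P n x = ∑ j ∈ Finset.range n, (x : ℕ → ℂ) j • e j := by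
  simp [P, inner_e]

theorem norm_sq_sum_smul_e (n : ℕ) (c : ℕ → ℂ) :
    ‖∑ j ∈ Finset.range n, c j • e j‖ ^ 2 = ∑ j ∈ Finset.range n, ‖c j‖ ^ 2 := by
  have h := inner_self_eq_norm_sq_to_K (𝕜 := ℂ) (∑ j ∈ Finset.range n, c j • e j)
  rw [orthonormal_e.inner_sum] at h
  have h2 : ∀ w : ℂ, (starRingEnd ℂ) w * w = ((‖w‖ ^ 2 : ℝ) : ℂ) := fun w => by
    rw [Complex.conj_mul']; push_cast; rfl
  simp only [h2] at h
  apply Complex.ofReal_injective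
  push_cast at h ⊢
  exact h.symm

theorem norm_sq_P (n : ℕ) (x : Hsp) :
    ‖P n x‖ ^ 2 = ∑ j ∈ Finset.range n, ‖(x : ℕ → ℂ) j‖ ^ 2 := by
  rw [P_apply, norm_sq_sum_smul_e]

theorem norm_P_le (n : ℕ) (x : Hsp) : ‖P n x‖ ≤ ‖x‖ := by
  refine le_of_sq_le_sq ?_ (norm_nonneg _)
  rw [norm_sq_P]
  simpa [inner_e] using orthonormal_e.sum_inner_products_le x (s := Finset.range n)

theorem P_P_of_le {m n : ℕ} (h : m ≤ n) (x : Hsp) : P n (P m x) = P m x := by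
  apply lp.ext
  funext i
  rw [P_coord, P_coord]
  split_ifs <;> first | rfl | omega

theorem P_sum_smul_e (n : ℕ) (c : ℕ → ℂ) :
    P n (∑ j ∈ Finset.range n, c j • e j) = ∑ j ∈ Finset.range n, c j • e j := by
  rw [map_sum]
  refine Finset.sum_congr rfl fun j hj => ?_
  rw [map_smul, P_apply, Finset.sum_eq_single_of_mem j hj]
  · simp [e]
  · intro i _ hij
    simp [e, hij]

/-- A finitely supported vector is fixed by all `P n` with `n` large. -/
theorem exists_P_eq_of_mem_finSpan {v : Hsp} (hv : v ∈ finSpan) : ∃ N, P N v = v := by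
  induction hv using Submodule.span_induction with
  | mem x hx =>
    obtain ⟨j, rfl⟩ := hx
    refine ⟨j + 1, ?_⟩
    have h := P_sum_smul_e (j + 1) (fun i => if i = j then 1 else 0)
    simpa using h
  | zero => exact ⟨0, map_zero _⟩
  | add x y _ _ hx hy =>
    obtain ⟨M, hM⟩ := hx
    obtain ⟨N, hN⟩ := hy
    refine ⟨max M N, ?_⟩
    rw [map_add]
    congr 1
    · rw [← hM, P_P_of_le (le_max_left _ _)]
    · rw [← hN, P_P_of_le (le_max_right _ _)]
  | smul a x _ hx =>
    obtain ⟨N, hN⟩ := hx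
    exact ⟨N, by rw [map_smul, hN]⟩

/-! ### The resolvent of a normal operator -/

section Resolvent

variable {T : Hsp →ₗ.[ℂ] Hsp} {z : ℂ} {R : Hsp →L[ℂ] Hsp}

theorem IsResolventAt.apply_mem (hR : IsResolventAt T z R) (x : Hsp) : R x ∈ T.domain :=
  (hR.1 x).1

theorem IsResolventAt.app_sub (hR : IsResolventAt T z R) (x : Hsp) :
    app T (R x) - z • R x = x := by
  obtain ⟨h, h'⟩ := hR.1 x
  rwa [app_of_mem h]

theorem IsResolventAt.apply_app_sub (hR : IsResolventAt T z R) {v : Hsp} (hv : v ∈ T.domain) :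
    R (app T v - z • v) = v := by
  rw [app_of_mem hv]
  exact hR.2 ⟨v, hv⟩

theorem app_add {u v : Hsp} (hu : u ∈ T.domain) (hv : v ∈ T.domain) :
    app T (u + v) = app T u + app T v := by
  rw [app_of_mem hu, app_of_mem hv, app_of_mem (add_mem hu hv), ← LinearPMap.map_add]
  rfl

theorem app_smul {u : Hsp} (c : ℂ) (hu : u ∈ T.domain) : app T (c • u) = c • app T u := by
  rw [app_of_mem hu, app_of_mem (T.domain.smul_mem c hu), ← LinearPMap.map_smul]
  rfl

/-- If `1 + (z - l) R(z,T)` is invertible, then `l` is not in the spectrum: the resolvent at `l`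
is `R(z,T) (1 + (z - l) R(z,T))⁻¹`. -/
theorem IsResolventAt.notMem_specT_of_isUnit (hR : IsResolventAt T z R) {l : ℂ}
    (hu : IsUnit (1 + (z - l) • R)) : l ∉ specT T := by
  obtain ⟨u, hu⟩ := hu
  have hcomm : Commute (u : Hsp →L[ℂ] Hsp) R := by
    rw [hu]
    exact (Commute.one_left R).add_left ((Commute.refl R).smul_left _)
  have hcomm' : (↑u⁻¹ : Hsp →L[ℂ] Hsp) * R = R * ↑u⁻¹ := hcomm.units_inv_left.eq
  have h1 : ∀ x, (u : Hsp →L[ℂ] Hsp) ((↑u⁻¹ : Hsp →L[ℂ] Hsp) x) = x := fun x => by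
    rw [← mul_apply_eq_comp, Units.mul_inv]; rfl
  have h2 : ∀ x, (↑u⁻¹ : Hsp →L[ℂ] Hsp) ((u : Hsp →L[ℂ] Hsp) x) = x := fun x => by
    rw [← mul_apply_eq_comp, Units.inv_mul]; rfl
  have hux : ∀ x, (u : Hsp →L[ℂ] Hsp) x = x + (z - l) • R x := fun x => by
    rw [hu]; simp
  simp only [specT, Set.mem_ofPred_eq, not_not]
  refine ⟨R * ↑u⁻¹, fun x => ?_, fun y => ?_⟩
  · have hmem : (R * (↑u⁻¹ : Hsp →L[ℂ] Hsp)) x ∈ T.domain := hR.apply_mem _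
    refine ⟨hmem, ?_⟩
    rw [← app_of_mem hmem, mul_apply_eq_comp]
    set w := (↑u⁻¹ : Hsp →L[ℂ] Hsp) x
    have h3 := hR.app_sub w
    have h4 : w + (z - l) • R w = x := by rw [← hux, h1]
    rw [← h4]
    nth_rw 3 [← h3]
    module
  · rw [← hcomm', mul_apply_eq_comp]
    have h5 : R (T y - l • (y : Hsp)) = (u : Hsp →L[ℂ] Hsp) y := by
      rw [hux]
      have h6 := hR.2 y
      have h7 : T y - l • (y : Hsp) = (T y - z • (y : Hsp)) + (z - l) • (y : Hsp) := by module
      rw [h7, map_add, h6, map_smul]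
    rw [h5, h2]

/-- Conversely, `1 + (z - l) R(z,T)` is invertible for `l` outside the spectrum, with inverse
`1 + (l - z) R(l,T)`. -/
theorem IsResolventAt.isUnit_of_notMem_specT (hR : IsResolventAt T z R) {l : ℂ}
    (hl : l ∉ specT T) : IsUnit (1 + (z - l) • R) := by
  have hL := resolv_spec hl
  set L := resolv l T
  have key : ∀ {a b : ℂ} {A B : Hsp →L[ℂ] Hsp}, IsResolventAt T a A → IsResolventAt T b B →
      (1 + (a - b) • A) * (1 + (b - a) • B) = 1 := by
    intro a b A B hA hB
    ext1 x
    have h1 := hA.apply_app_sub (hB.apply_mem x)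
    have h2 := hB.app_sub x
    have h3 : app T (B x) - a • B x = x + (b - a) • B x := by
      rw [sub_eq_iff_eq_add.1 h2]
      module
    rw [h3] at h1
    simp only [mul_apply_eq_comp, add_apply,
      one_apply_eq_self, smul_apply]
    rw [h1]
    module
  exact ⟨⟨1 + (z - l) • R, 1 + (l - z) • L, key hR hL, key hL hR⟩, rfl⟩

variable (hT : IsNormalOp T)
include hT

theorem IsNormalOp.inner_adjoint {u v : Hsp} (hu : u ∈ T.domain) (hv : v ∈ T†.domain) :
    inner ℂ (app T† v) u = inner ℂ v (app T u) := by
  rw [app_of_mem hu, app_of_mem hv]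
  exact LinearPMap.adjoint_isFormalAdjoint hT.dense ⟨v, hv⟩ ⟨u, hu⟩

/-- The polarized form of `‖T v‖ = ‖T* v‖`. -/
theorem IsNormalOp.inner_app_app {u v : Hsp} (hu : u ∈ T.domain) (hv : v ∈ T.domain) :
    inner ℂ (app T u) (app T v) = inner ℂ (app T† u) (app T† v) := by
  have hu' : u ∈ T†.domain := hT.domain_eq ▸ hu
  have hv' : v ∈ T†.domain := hT.domain_eq ▸ hv
  have key : ∀ c : ℂ, ‖app T u + c • app T v‖ = ‖app T† u + c • app T† v‖ := fun c => by
    rw [← app_smul c hv, ← app_add hu (T.domain.smul_mem c hv), ← app_smul c hv',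
      ← app_add hu' (T†.domain.smul_mem c hv')]
    exact hT.norm_eq _ (add_mem hu (T.domain.smul_mem c hv))
  have h1 := key 1
  have h2 := key (-1)
  have h3 := key Complex.I
  have h4 := key (-Complex.I)
  simp only [one_smul, neg_smul, ← sub_eq_add_neg] at h1 h2 h3 h4
  rw [inner_eq_sum_norm_sq_div_four, inner_eq_sum_norm_sq_div_four (𝕜 := ℂ) (app T† u)]
  simp only [RCLike.I_to_complex]
  rw [h1, h2, h3, h4]

/-- `T - z` and `T* - z̄` have the same polarized norms. -/
theorem IsNormalOp.inner_app_sub {u v : Hsp} (hu : u ∈ T.domain) (hv : v ∈ T.domain) :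
    inner ℂ (app T u - z • u) (app T v - z • v) =
      inner ℂ (app T† u - (starRingEnd ℂ) z • u) (app T† v - (starRingEnd ℂ) z • v) := by
  have hu' : u ∈ T†.domain := hT.domain_eq ▸ hu
  have hv' : v ∈ T†.domain := hT.domain_eq ▸ hv
  have h1 := hT.inner_app_app hu hv
  have h2 := hT.inner_adjoint hu hv'
  have h3 := hT.inner_adjoint hv hu'
  have h2' : inner ℂ u (app T† v) = inner ℂ (app T u) v := by
    rw [← inner_conj_symm, h2, inner_conj_symm]
  simp only [inner_sub_left, inner_sub_right, inner_smul_left, inner_smul_right,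
    Complex.conj_conj]
  rw [h1, h3, h2']
  ring

/-- The adjoint of the resolvent is a right inverse of `T* - z̄`. -/
theorem IsNormalOp.adjoint_resolvent (hR : IsResolventAt T z R) (x : Hsp) :
    ContinuousLinearMap.adjoint R x ∈ T.domain ∧
      app T† (ContinuousLinearMap.adjoint R x) -
        (starRingEnd ℂ) z • ContinuousLinearMap.adjoint R x = x := by
  set y := ContinuousLinearMap.adjoint R x
  have key : ∀ u : T.domain, inner ℂ (x + (starRingEnd ℂ) z • y) (u : Hsp) =
      inner ℂ y (T u) := by
    intro u
    have h1 : inner ℂ y (T u - z • (u : Hsp)) = inner ℂ x (u : Hsp) := by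
      rw [ContinuousLinearMap.adjoint_inner_left, hR.2 u]
    rw [inner_add_left, ← h1, inner_sub_right, inner_smul_left, inner_smul_right,
      Complex.conj_conj]
    ring
  have hy : y ∈ T†.domain := LinearPMap.mem_adjoint_domain_of_exists y ⟨_, key⟩
  refine ⟨hT.domain_eq ▸ hy, ?_⟩
  rw [app_of_mem hy, LinearPMap.adjoint_apply_eq hT.dense ⟨y, hy⟩ key]
  simp

/-- The resolvent of a normal operator is a bounded normal operator. With `S = T - z` and
`w = R* R x` one has `⟨S w, S u⟩ = ⟨S* w, S* u⟩ = ⟨R x, S* u⟩ = ⟨x, u⟩` for `u` in the domain,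
hence `S w = R* x`, that is `R* R x = R R* x`. -/
theorem IsNormalOp.isStarNormal_resolvent (hR : IsResolventAt T z R) : IsStarNormal R := by
  refine ⟨?_⟩
  change star R * R = R * star R
  ext1 x
  change ContinuousLinearMap.adjoint R (R x) = R (ContinuousLinearMap.adjoint R x)
  obtain ⟨hw, hw'⟩ := hT.adjoint_resolvent hR (R x)
  set w := ContinuousLinearMap.adjoint R (R x)
  have h1 : ∀ v, inner ℂ (app T w - z • w) v = inner ℂ (ContinuousLinearMap.adjoint R x) v := by
    intro v
    have hv := hR.apply_mem v
    have hv' : R v ∈ T†.domain := hT.domain_eq ▸ hv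
    conv_lhs => rw [← hR.app_sub v]
    rw [hT.inner_app_sub hw hv, hw', ContinuousLinearMap.adjoint_inner_left]
    have h2 : inner ℂ (R x) (app T† (R v)) = inner ℂ (app T (R x)) (R v) := by
      rw [← inner_conj_symm, hT.inner_adjoint (hR.apply_mem x) hv', inner_conj_symm]
    have h3 : inner ℂ (app T (R x) - z • R x) (R v) = inner ℂ x (R v) := by rw [hR.app_sub]
    rw [inner_sub_right, inner_smul_right, h2, ← h3, inner_sub_left, inner_smul_left]
  have h4 : app T w - z • w = ContinuousLinearMap.adjoint R x := ext_inner_right ℂ h1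
  rw [← h4, hR.apply_app_sub hw]

theorem IsResolventAt.ne_zero (hR : IsResolventAt T z R) : R ≠ 0 := by
  rintro rfl
  have h := hR.apply_app_sub (e_mem hT.toIsAdmissible 0)
  have h0 := orthonormal_e.ne_zero 0
  exact h0 (by simpa using h.symm)

/-- A normal operator has `0 < dist(z, σ(T))` and `‖R(z,T)‖ ≤ 1 / dist(z, σ(T))`, since the norm
of the normal operator `R(z,T)` is its spectral radius. -/
theorem IsNormalOp.norm_resolvent_le (hR : IsResolventAt T z R) :
    0 < Metric.infDist z (specT T) ∧ ‖R‖ ≤ 1 / Metric.infDist z (specT T) := by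
  have hR0 : 0 < ‖R‖ := norm_pos_iff.2 (hR.ne_zero hT)
  have := hT.isStarNormal_resolvent hR
  have : Nontrivial (Hsp →L[ℂ] Hsp) := ⟨R, 0, hR.ne_zero hT⟩
  obtain ⟨μ, hμ, hμR⟩ := spectrum.exists_nnnorm_eq_spectralRadius R
  rw [IsStarNormal.spectralRadius_eq_nnnorm] at hμR
  have hμR' : ‖μ‖ = ‖R‖ :=
    congrArg NNReal.toReal (ENNReal.coe_injective hμR)
  have hμ0 : μ ≠ 0 := fun h => by simp [h] at hμR'; exact hR0.ne hμR'
  have hmem : z + μ⁻¹ ∈ specT T := by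
    by_contra hl
    have hu := hR.isUnit_of_notMem_specT hl
    apply hμ
    have h1 : algebraMap ℂ (Hsp →L[ℂ] Hsp) μ - R = μ • (1 + (z - (z + μ⁻¹)) • R) := by
      rw [Algebra.algebraMap_eq_smul_one, smul_add, smul_smul]
      have : μ * (z - (z + μ⁻¹)) = -1 := by field_simp; ring
      rw [this]
      module
    change IsUnit _
    rw [h1]
    exact (isUnit_smul_iff (Units.mk0 μ hμ0) _).2 hu
  have hlow : ‖R‖⁻¹ ≤ Metric.infDist z (specT T) := by
    rw [Metric.le_infDist ⟨_, hmem⟩]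
    intro l hl
    by_contra! hlt
    refine hR.notMem_specT_of_isUnit ?_ hl
    have h1 : ‖(l - z) • R‖ < 1 := by
      rw [norm_smul]
      rw [dist_comm, Complex.dist_eq] at hlt
      calc ‖l - z‖ * ‖R‖ < ‖R‖⁻¹ * ‖R‖ := mul_lt_mul_of_pos_right hlt hR0
        _ = 1 := inv_mul_cancel₀ hR0.ne'
    have h2 := isUnit_one_sub_of_norm_lt_one h1
    have h3 : (1 : Hsp →L[ℂ] Hsp) - (l - z) • R = 1 + (z - l) • R := by module
    rwa [h3] at h2
  have hpos : 0 < Metric.infDist z (specT T) := lt_of_lt_of_le (inv_pos.2 hR0) hlow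
  refine ⟨hpos, ?_⟩
  have hup : Metric.infDist z (specT T) ≤ ‖R‖⁻¹ := by
    have := Metric.infDist_le_dist_of_mem (x := z) hmem
    rwa [Complex.dist_eq, sub_add_cancel_left, norm_neg, norm_inv, hμR'] at this
  rw [one_div]
  exact (le_inv_comm₀ hR0 hpos).2 hup

end Resolvent

/-! ### Residuals and the error of approximate solutions -/

section ErrorBound

variable {T : Hsp →ₗ.[ℂ] Hsp} {z : ℂ} {R : Hsp →L[ℂ] Hsp}

/-- The a posteriori bound: `y - R(z,T) x = R(z,T) ((T - z) y - x)`, and outside the range of `P_N`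
the residual `(T - z) y - x` consists of `(1 - P_N) T P_n y` and `(1 - P_N) x` only. -/
theorem IsAdmissible.norm_sub_resolvent_le (hT : IsAdmissible T) (hR : IsResolventAt T z R)
    {n N : ℕ} (hnN : n ≤ N) {y : Hsp} (hy : P n y = y) (x : Hsp) :
    ‖y - R x‖ ≤ ‖R‖ * (‖P N x - x‖ + ‖(1 - P N) ∘L truncation T n‖ * ‖y‖ +
      ‖P N (app T y - z • y) - P N x‖) := by
  have hyT : y ∈ T.domain := hy ▸ P_mem hT n y
  have htr : truncation T n y = app T y := by
    rw [truncation_apply hT, app_of_mem hyT]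
    congr 2
  have hPy : P N y = y := by rw [← hy, P_P_of_le hnN]
  have h1 : y - R x = R (app T y - z • y - x) := by
    rw [map_sub, hR.apply_app_sub hyT]
  have h2 : app T y - z • y - x = (P N x - x) + ((1 - P N) ∘L truncation T n) y +
      (P N (app T y - z • y) - P N x) := by
    rw [ContinuousLinearMap.comp_apply, htr, map_sub, map_smul, hPy, sub_apply,
      one_apply_eq_self]
    module
  rw [h1]
  refine (R.le_opNorm _).trans (mul_le_mul_of_nonneg_left ?_ (norm_nonneg _))
  rw [h2]
  refine (norm_add_le _ _).trans (add_le_add_left ((norm_add_le _ _).trans ?_) _)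
  gcongr
  exact ContinuousLinearMap.le_opNorm _ _

/-- Vectors `y_n` in the range of `P_n` whose residuals `P_{f(n)} ((T - z) y_n - x)` tend to zero
converge to `R(z,T) x`. -/
theorem tendsto_of_residual {f : ℕ → ℕ} {α β : ℕ → ℝ} {x : Hsp}
    (hf : ∀ n, 1 ≤ n → n < f n) (hα : Tendsto α atTop (𝓝 0)) (hβ : Tendsto β atTop (𝓝 0))
    (hTx : (T, x) ∈ decayClass f α β) (hR : IsResolventAt T z R) {y : ℕ → Hsp}
    (hy : ∀ n, P n (y n) = y n)
    (hres : Tendsto (fun n => ‖P (f n) (app T (y n) - z • y n) - P (f n) x‖) atTop (𝓝 0)) :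
    Tendsto y atTop (𝓝 (R x)) := by
  obtain ⟨hT, h1, h2⟩ := hTx
  have hδ : Tendsto (fun n => ‖(1 - P (f n)) ∘L truncation T n‖) atTop (𝓝 0) := by
    refine (h1.trans_tendsto hα).congr fun n => ?_
    rw [← norm_neg, ← ContinuousLinearMap.neg_comp, neg_sub]
  have hfat : Tendsto f atTop atTop := by
    refine tendsto_atTop_mono' _ ?_ tendsto_id
    filter_upwards [eventually_ge_atTop 1] with n hn using (hf n hn).le
  have hx : Tendsto (fun n => ‖P (f n) x - x‖) atTop (𝓝 0) := (h2.trans_tendsto hβ).comp hfat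
  rw [tendsto_iff_norm_sub_tendsto_zero]
  have hbound : Tendsto (fun n => 2 * ‖R‖ * (‖P (f n) x - x‖ +
      ‖(1 - P (f n)) ∘L truncation T n‖ * ‖R x‖ +
      ‖P (f n) (app T (y n) - z • y n) - P (f n) x‖)) atTop (𝓝 0) := by
    simpa using ((hx.add (hδ.mul_const ‖R x‖)).add hres).const_mul (2 * ‖R‖)
  refine squeeze_zero' (Eventually.of_forall fun _ => norm_nonneg _) ?_ hbound
  have hsmall : ∀ᶠ n in atTop, ‖R‖ * ‖(1 - P (f n)) ∘L truncation T n‖ < 1 / 2 := by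
    have := hδ.const_mul ‖R‖
    rw [mul_zero] at this
    exact this.eventually_lt_const (by norm_num)
  filter_upwards [eventually_ge_atTop 1, hsmall] with n hn hs
  have hb := hT.norm_sub_resolvent_le hR (hf n hn).le (hy n) x
  have hyn : ‖y n‖ ≤ ‖y n - R x‖ + ‖R x‖ := by
    simpa using norm_add_le (y n - R x) (R x)
  set δ := ‖(1 - P (f n)) ∘L truncation T n‖
  -- the term `‖R‖ δ ‖y n - R x‖ ≤ ‖y n - R x‖ / 2` is absorbed by the left-hand side
  have h3 : ‖R‖ * δ * ‖y n‖ ≤ ‖R‖ * δ * (‖y n - R x‖ + ‖R x‖) := by gcongr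
  have h4 : ‖R‖ * δ * ‖y n - R x‖ ≤ 1 / 2 * ‖y n - R x‖ := by gcongr
  linarith

end ErrorBound

/-! ### Rational candidates -/

/-- The `i`-th number coded by `m` at stage `n`: Gödel's `β`-function of the pair
`(m / (n + 1), m % (n + 1))`. -/
def digit (n m i : ℕ) : ℕ := (m / (n + 1)) % ((i + 1) * (m % (n + 1)) + 1)

/-- This is `1` for `j` below the length coded by `m`, and `0` otherwise. -/
def cutoff (n m j : ℕ) : ℕ := 1 - (1 - (digit n m 1 - j))

/-- Numerator of the real part of the `j`-th coefficient of the candidate coded by `m`. -/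
def reNum (n m j : ℕ) : ℝ :=
  cutoff n m j * (digit n m (4 * j + 2) : ℝ) - cutoff n m j * (digit n m (4 * j + 3) : ℝ)

/-- Numerator of the imaginary part of the `j`-th coefficient of the candidate coded by `m`. -/
def imNum (n m j : ℕ) : ℝ :=
  cutoff n m j * (digit n m (4 * j + 4) : ℝ) - cutoff n m j * (digit n m (4 * j + 5) : ℝ)

/-- The common denominator of the coefficients of the candidate coded by `m`. -/
def denom (n m : ℕ) : ℝ := (digit n m 0 : ℝ) + 1

theorem denom_pos (n m : ℕ) : 0 < denom n m := by unfold denom; positivity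

/-- The `m`-th candidate at stage `n`, a vector in `ℚ[i]ⁿ`. -/
noncomputable def candidate (n m : ℕ) : Hsp :=
  ∑ j ∈ Finset.range n, (⟨reNum n m j / denom n m, imNum n m j / denom n m⟩ : ℂ) • e j

theorem P_candidate (n m : ℕ) : P n (candidate n m) = candidate n m := P_sum_smul_e n _

theorem candidate_mem {T : Hsp →ₗ.[ℂ] Hsp} (hT : IsAdmissible T) (n m : ℕ) :
    candidate n m ∈ T.domain := P_candidate n m ▸ P_mem hT n _

theorem finite_support_candidate (n m : ℕ) : {i : ℕ | (candidate n m : ℕ → ℂ) i ≠ 0}.Finite := by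
  refine (Set.finite_lt_nat n).subset fun i hi => ?_
  by_contra hin
  apply hi
  rw [← P_candidate, P_coord]
  exact if_neg hin

theorem app_sum_smul_e {T : Hsp →ₗ.[ℂ] Hsp} (hT : IsAdmissible T) (n : ℕ) (c : ℕ → ℂ) :
    app T (∑ j ∈ Finset.range n, c j • e j) = ∑ j ∈ Finset.range n, c j • app T (e j) := by
  have hm : ∀ k, ∑ j ∈ Finset.range k, c j • e j ∈ T.domain := fun k =>
    Submodule.sum_mem _ fun j _ => T.domain.smul_mem _ (e_mem hT j)
  induction n with
  | zero => simpa using app_smul 0 (e_mem hT 0)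
  | succ n ih =>
    rw [Finset.sum_range_succ, Finset.sum_range_succ,
      app_add (hm n) (T.domain.smul_mem _ (e_mem hT n)), ih, app_smul _ (e_mem hT n)]

/-- From some stage on, every finite string of naturals is coded by some `m ≤ (n + 1)²`. -/
theorem exists_digit_eq (h : ℕ → ℕ) (M : ℕ) :
    ∃ n₀, ∀ n, n₀ ≤ n → ∃ m ≤ (n + 1) * (n + 1), ∀ i < M, digit n m i = h i := by
  set l := List.ofFn (fun i : Fin M => h i)
  -- `m = c (n + 1) + d` codes the pair `(c, d)` as soon as `c, d ≤ n`
  set c := (Nat.unbeta l).unpair.1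
  set d := (Nat.unbeta l).unpair.2
  refine ⟨max c d, fun n hn => ⟨c * (n + 1) + d, ?_, fun i hi => ?_⟩⟩
  · have hc : c ≤ n := (le_max_left _ _).trans hn
    have hd : d ≤ n := (le_max_right _ _).trans hn
    nlinarith
  · have hd : d < n + 1 := Nat.lt_succ_of_le ((le_max_right _ _).trans hn)
    have h1 : (c * (n + 1) + d) / (n + 1) = c := by
      rw [mul_comm, Nat.mul_add_div (Nat.succ_pos n), Nat.div_eq_of_lt hd, add_zero]
    have h2 : (c * (n + 1) + d) % (n + 1) = d := by
      rw [mul_comm, Nat.mul_add_mod, Nat.mod_eq_of_lt hd]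
    have h3 := Nat.beta_unbeta_coe l ⟨i, by simpa [l] using hi⟩
    rw [digit, h1, h2]
    simpa [Nat.beta, l] using h3

/-- Every real `a` is a limit of fractions with denominators `D + 1` whose numerators are
differences of the naturals coding the positive and the negative part of `a`. -/
theorem tendsto_floor_div (a : ℝ) :
    Tendsto (fun D : ℕ => ((⌊max a 0 * (D + 1 : ℕ)⌋₊ : ℝ) - ⌊max (-a) 0 * (D + 1 : ℕ)⌋₊) /
      ((D : ℝ) + 1)) atTop (𝓝 a) := by
  have h : ∀ b : ℝ, 0 ≤ b →
      Tendsto (fun D : ℕ => (⌊b * (D + 1 : ℕ)⌋₊ : ℝ) / ((D : ℝ) + 1)) atTop (𝓝 b) := by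
    intro b hb
    have h1 := (tendsto_nat_floor_mul_div_atTop hb).comp
      ((tendsto_natCast_atTop_atTop (R := ℝ)).comp (tendsto_add_atTop_nat 1))
    simpa [Function.comp_def] using h1
  have h2 := (h _ (le_max_right a 0)).sub (h _ (le_max_right (-a) 0))
  rw [max_zero_sub_max_neg_zero_eq_self] at h2
  simpa only [sub_div] using h2

/-- Since the finitely supported vectors form a core, they approximate `R(z,T) x`
in the graph norm. -/
theorem IsAdmissible.exists_residual_lt {T : Hsp →ₗ.[ℂ] Hsp} (hT : IsAdmissible T) {z : ℂ}
    {R : Hsp →L[ℂ] Hsp} (hR : IsResolventAt T z R) (x : Hsp) {ε : ℝ} (hε : 0 < ε) :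
    ∃ u ∈ finSpan, ‖app T u - z • u - x‖ < ε := by
  have hcl : (T.domRestrict finSpan).IsClosable :=
    hT.closed.isClosable.leIsClosable LinearPMap.domRestrict_le
  have hg : T.graph = (T.domRestrict finSpan).graph.topologicalClosure := by
    rw [hcl.graph_closure_eq_closure_graph, hT.core.closure_eq]
  have hmem : (R x, app T (R x)) ∈ closure ((T.domRestrict finSpan).graph : Set (Hsp × Hsp)) := by
    rw [← Submodule.topologicalClosure_coe, ← hg, app_of_mem (hR.apply_mem x)]
    exact T.mem_graph ⟨R x, hR.apply_mem x⟩
  have hopen : IsOpen {p : Hsp × Hsp | ‖p.2 - z • p.1 - x‖ < ε} :=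
    isOpen_lt (by fun_prop) continuous_const
  obtain ⟨⟨u, w⟩, hlt, huw⟩ := mem_closure_iff.1 hmem _ hopen (by
    change ‖app T (R x) - z • R x - x‖ < ε
    rw [hR.app_sub]; simpa using hε)
  obtain ⟨a, ha1, ha2⟩ := (LinearPMap.mem_graph_iff _).1 huw
  have hau : (a : Hsp) ∈ finSpan ⊓ T.domain := a.2
  simp only at ha1 ha2
  refine ⟨u, ha1 ▸ hau.1, ?_⟩
  have hw : app T u = w := by
    rw [app_of_mem (ha1 ▸ hau.2 : u ∈ T.domain), ← ha2]
    exact (LinearPMap.domRestrict_apply (y := ⟨u, ha1 ▸ hau.2⟩) ha1).symm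
  rw [hw]
  exact hlt

/-- The residuals of suitable candidates are arbitrarily small, from some stage on. -/
theorem IsAdmissible.exists_candidate_lt {T : Hsp →ₗ.[ℂ] Hsp} (hT : IsAdmissible T) {z : ℂ}
    {R : Hsp →L[ℂ] Hsp} (hR : IsResolventAt T z R) (x : Hsp) {ε : ℝ} (hε : 0 < ε) :
    ∃ n₀, ∀ n, n₀ ≤ n → ∃ m ≤ (n + 1) * (n + 1),
      ‖app T (candidate n m) - z • candidate n m - x‖ < ε := by
  obtain ⟨u, hu, hux⟩ := hT.exists_residual_lt hR x hε
  obtain ⟨N, hN⟩ := exists_P_eq_of_mem_finSpan hu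
  set w : ℕ → ℂ := fun j => (u : ℕ → ℂ) j
  have huw : u = ∑ j ∈ Finset.range N, w j • e j := by rw [← P_apply, hN]
  set a : ℕ → ℕ → ℂ := fun D j =>
    ⟨((⌊max (w j).re 0 * (D + 1 : ℕ)⌋₊ : ℝ) - ⌊max (-(w j).re) 0 * (D + 1 : ℕ)⌋₊) / ((D : ℝ) + 1),
      ((⌊max (w j).im 0 * (D + 1 : ℕ)⌋₊ : ℝ) - ⌊max (-(w j).im) 0 * (D + 1 : ℕ)⌋₊) / ((D : ℝ) + 1)⟩
    with ha_def
  have ha : ∀ j, Tendsto (fun D => a D j) atTop (𝓝 (w j)) := by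
    intro j
    have h := (Complex.continuous_ofReal.tendsto _ |>.comp (tendsto_floor_div (w j).re)).add
      ((Complex.continuous_ofReal.tendsto _ |>.comp
        (tendsto_floor_div (w j).im)).mul_const Complex.I)
    rw [Complex.re_add_im] at h
    refine h.congr fun D => ?_
    simp only [Function.comp_apply, ha_def, Complex.mk_eq_add_mul_I]
  have hres : ∀ c : ℕ → ℂ, app T (∑ j ∈ Finset.range N, c j • e j) -
      z • (∑ j ∈ Finset.range N, c j • e j) - x =
      ∑ j ∈ Finset.range N, c j • (app T (e j) - z • e j) - x := by
    intro c
    rw [app_sum_smul_e hT, Finset.smul_sum, ← Finset.sum_sub_distrib]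
    congr 1
    refine Finset.sum_congr rfl fun j _ => ?_
    module
  have hlim : Tendsto (fun D => ‖∑ j ∈ Finset.range N, a D j • (app T (e j) - z • e j) - x‖)
      atTop (𝓝 ‖app T u - z • u - x‖) := by
    rw [huw, hres]
    exact ((tendsto_finsetSum _ fun j _ => (ha j).smul_const _).sub_const x).norm
  obtain ⟨D, hD⟩ := (hlim.eventually_lt_const hux).exists
  obtain ⟨n₀, hn₀⟩ := exists_digit_eq (fun i => if i = 0 then D else if i = 1 then N else
    if (i - 2) % 4 = 0 then ⌊max (w ((i - 2) / 4)).re 0 * (D + 1 : ℕ)⌋₊ else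
    if (i - 2) % 4 = 1 then ⌊max (-(w ((i - 2) / 4)).re) 0 * (D + 1 : ℕ)⌋₊ else
    if (i - 2) % 4 = 2 then ⌊max (w ((i - 2) / 4)).im 0 * (D + 1 : ℕ)⌋₊ else
    ⌊max (-(w ((i - 2) / 4)).im) 0 * (D + 1 : ℕ)⌋₊) (4 * N + 2)
  refine ⟨max n₀ N, fun n hn => ?_⟩
  obtain ⟨m, hm, hdig⟩ := hn₀ n ((le_max_left _ _).trans hn)
  have hNn : N ≤ n := (le_max_right _ _).trans hn
  refine ⟨m, hm, ?_⟩
  have h0 : digit n m 0 = D := by rw [hdig 0 (by omega)]; simp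
  have h1 : digit n m 1 = N := by rw [hdig 1 (by omega)]; simp
  have hcand : candidate n m = ∑ j ∈ Finset.range N, a D j • e j := by
    have hsub : Finset.range N ⊆ Finset.range n := Finset.range_subset_range.2 hNn
    rw [candidate, ← Finset.sum_subset hsub]
    · refine Finset.sum_congr rfl fun j hj => ?_
      have hj : j < N := Finset.mem_range.1 hj
      have hc : cutoff n m j = 1 := by rw [cutoff, h1]; omega
      have e2 : digit n m (4 * j + 2) = ⌊max (w j).re 0 * (D + 1 : ℕ)⌋₊ := by
        rw [hdig _ (by omega)]; simp
      have e3 : digit n m (4 * j + 3) = ⌊max (-(w j).re) 0 * (D + 1 : ℕ)⌋₊ := by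
        rw [hdig _ (by omega)]
        simp [show (4 * j + 1) / 4 = j by omega]
      have e4 : digit n m (4 * j + 4) = ⌊max (w j).im 0 * (D + 1 : ℕ)⌋₊ := by
        rw [hdig _ (by omega)]
        simp [show (4 * j + 2) / 4 = j by omega]
      have e5 : digit n m (4 * j + 5) = ⌊max (-(w j).im) 0 * (D + 1 : ℕ)⌋₊ := by
        rw [hdig _ (by omega)]
        simp [show (4 * j + 3) / 4 = j by omega]
      simp only [reNum, imNum, denom, hc, e2, e3, e4, e5, h0, ha_def, Nat.cast_one, one_mul]
    · intro j _ hj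
      have hj : N ≤ j := by simpa using hj
      have hc : cutoff n m j = 0 := by rw [cutoff, h1]; omega
      have : (⟨0, 0⟩ : ℂ) = 0 := rfl
      simp [reNum, imNum, hc, this]
  rw [hcand, hres]
  exact hD

/-! ### The best candidate -/

/-- The first index in `{0, …, m}` at which `g` is minimal. -/
noncomputable def bestIndex (g : ℕ → ℝ) : ℕ → ℕ
  | 0 => 0
  | m + 1 => open Classical in if g (m + 1) < g (bestIndex g m) then m + 1 else bestIndex g m

theorem apply_bestIndex_le (g : ℕ → ℝ) {i m : ℕ} (h : i ≤ m) : g (bestIndex g m) ≤ g i := by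
  induction m with
  | zero => obtain rfl : i = 0 := by omega
            exact le_rfl
  | succ m ih =>
    rw [bestIndex]
    rcases Nat.le_succ_iff.1 h with h | rfl
    · split_ifs with hlt
      · exact hlt.le.trans (ih h)
      · exact ih h
    · split_ifs with hlt
      · exact le_rfl
      · exact not_lt.1 hlt

/-- The squared residual `‖P_{f(n)} (T - z) y - P_{f(n)} x‖²` of the candidate `y` coded by `m`. -/
noncomputable def residualSq (f : ℕ → ℕ) (T : Hsp →ₗ.[ℂ] Hsp) (x : Hsp) (z : ℂ) (n m : ℕ) : ℝ :=
  ‖P (f n) (app T (candidate n m) - z • candidate n m) - P (f n) x‖ ^ 2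

/-- The code of the candidate with the smallest residual at stage `n`. -/
noncomputable def bestCode (f : ℕ → ℕ) (T : Hsp →ₗ.[ℂ] Hsp) (x : Hsp) (z : ℂ) (n : ℕ) : ℕ :=
  bestIndex (residualSq f T x z n) ((n + 1) * (n + 1))

theorem tendsto_residual_bestCode {T : Hsp →ₗ.[ℂ] Hsp} (hT : IsAdmissible T) {z : ℂ}
    {R : Hsp →L[ℂ] Hsp} (hR : IsResolventAt T z R) (f : ℕ → ℕ) (x : Hsp) :
    Tendsto (fun n => ‖P (f n) (app T (candidate n (bestCode f T x z n)) -
      z • candidate n (bestCode f T x z n)) - P (f n) x‖) atTop (𝓝 0) := by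
  rw [Metric.tendsto_atTop]
  intro ε hε
  obtain ⟨n₀, hn₀⟩ := hT.exists_candidate_lt hR x hε
  refine ⟨n₀, fun n hn => ?_⟩
  obtain ⟨m, hm, hlt⟩ := hn₀ n hn
  rw [Real.dist_eq, sub_zero, abs_of_nonneg (norm_nonneg _)]
  have h1 : residualSq f T x z n (bestCode f T x z n) ≤ residualSq f T x z n m :=
    apply_bestIndex_le _ hm
  have h2 := le_of_sq_le_sq h1 (norm_nonneg _)
  refine h2.trans_lt (lt_of_le_of_lt ?_ hlt)
  rw [← map_sub]
  exact norm_P_le _ _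

/-! ### Total correctness of programs -/

section Wp

variable {Q : Type} {O : Oracle Q}

/-- Started in `s`, the program `p` halts in a store satisfying `Post`. -/
def Wp (O : Oracle Q) (p : Prog Q) (s : Store) (Post : Store → Prop) : Prop :=
  ∃ s', Exec O p s s' ∧ Post s'

theorem Wp.mono {p : Prog Q} {s : Store} {A B : Store → Prop} (h : Wp O p s A)
    (hAB : ∀ s', A s' → B s') : Wp O p s B :=
  let ⟨s', h1, h2⟩ := h
  ⟨s', h1, hAB s' h2⟩

theorem Wp.of_exec {p : Prog Q} {s s' : Store} {A : Store → Prop} (h : Exec O p s s')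
    (hA : A s') : Wp O p s A := ⟨s', h, hA⟩

theorem Wp.seq {p q : Prog Q} {s : Store} {A : Store → Prop}
    (h : Wp O p s fun s' => Wp O q s' A) : Wp O (.seq p q) s A :=
  let ⟨_, h1, s₂, h2, h3⟩ := h
  ⟨s₂, .seq h1 h2, h3⟩

theorem Wp.setVar {v : ℕ} {a : NatExp} {s : Store} {A : Store → Prop}
    (h : A ⟨Function.update s.var v (a.eval O s), s.mem⟩) : Wp O (.setVar v a) s A :=
  ⟨_, .setVar v a s, h⟩

theorem Wp.setCell {a : NatExp} {r : RealExp Q} {s : Store} {A : Store → Prop}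
    (h : A ⟨s.var, Function.update s.mem (a.eval O s) (r.eval O s)⟩) :
    Wp O (.setCell a r) s A :=
  ⟨_, .setCell a r s, h⟩

theorem Wp.setDiv {a : NatExp} {r t : RealExp Q} {s : Store} {A : Store → Prop}
    (h0 : t.eval O s ≠ 0)
    (h : A ⟨s.var, Function.update s.mem (a.eval O s) (r.eval O s / t.eval O s)⟩) :
    Wp O (.setDiv a r t) s A :=
  ⟨_, .setDiv a r t s h0, h⟩

/-- Run `body` with the register `v` taking the values `0, 1, …` as long as it is below `b`. -/
def forLoop (v : ℕ) (b : NatExp) (body : Prog Q) : Prog Q :=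
  .seq (.setVar v (.const 0))
    (.loop (.natLt (.var v) b) (.seq body (.setVar v (.add (.var v) (.const 1)))))

/-- The invariant rule for counting loops. -/
theorem Wp.forLoop {v : ℕ} {b : NatExp} {body : Prog Q} {s : Store} {A : Store → Prop} (N : ℕ)
    (Inv : ℕ → Store → Prop) (h0 : Inv 0 ⟨Function.update s.var v 0, s.mem⟩)
    (hb : ∀ i s, Inv i s → b.eval O s = N)
    (hstep : ∀ i < N, ∀ s, s.var v = i → Inv i s → Wp O body s fun s' =>
      s'.var v = i ∧ Inv (i + 1) ⟨Function.update s'.var v (i + 1), s'.mem⟩)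
    (hpost : ∀ s, s.var v = N → Inv N s → A s) : Wp O (forLoop v b body) s A := by
  have key : ∀ k i s, i + k = N → s.var v = i → Inv i s →
      Wp O (.loop (.natLt (.var v) b) (.seq body (.setVar v (.add (.var v) (.const 1))))) s A := by
    intro k
    induction k with
    | zero =>
      intro i s hi hv hI
      obtain rfl : i = N := hi
      refine ⟨s, .loopStop ?_, hpost s hv hI⟩
      change ¬ s.var v < b.eval O s
      rw [hb i s hI, hv]
      exact lt_irrefl _
    | succ k ih =>
      intro i s hi hv hI
      have hiN : i < N := by omega
      obtain ⟨s', h1, h2, h3⟩ := hstep i hiN s hv hI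
      obtain ⟨s'', h4, h5⟩ := ih (i + 1) ⟨Function.update s'.var v (i + 1), s'.mem⟩ (by omega)
        (by simp) h3
      refine ⟨s'', .loopStep ?_ (.seq h1 ?_) h4, h5⟩
      · change s.var v < b.eval O s
        rw [hb i s hI, hv]
        exact hiN
      · have h := Exec.setVar (O := O) v (.add (.var v) (.const 1)) s'
        simpa [NatExp.eval, h2] using h
  exact Wp.seq (Wp.setVar (key N 0 _ (by omega) (by simp [NatExp.eval]) h0))

/-- Store in the cell `a` the sum of the values of `r` as the register `v` runs below `b`. -/
def sumProg (a v : ℕ) (b : NatExp) (r : RealExp Q) : Prog Q :=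
  .seq (.setCell (.const a) (.ofNat (.const 0)))
    (forLoop v b (.setCell (.const a) (.add (.cell (.const a)) r)))

theorem exec_sumProg {a v : ℕ} {b : NatExp} {r : RealExp Q} {s : Store} (N : ℕ) (F : ℕ → ℝ)
    (hb : ∀ i t, b.eval O ⟨Function.update s.var v i, Function.update s.mem a t⟩ = N)
    (hr : ∀ i t, r.eval O ⟨Function.update s.var v i, Function.update s.mem a t⟩ = F i) :
    Exec O (sumProg a v b r) s
      ⟨Function.update s.var v N, Function.update s.mem a (∑ i ∈ Finset.range N, F i)⟩ := by
  have h : Wp O (sumProg a v b r) s (fun s' => s' =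
      ⟨Function.update s.var v N, Function.update s.mem a (∑ i ∈ Finset.range N, F i)⟩) := by
    refine Wp.seq (Wp.setCell (Wp.forLoop N (fun i s' => s' =
      ⟨Function.update s.var v i, Function.update s.mem a (∑ j ∈ Finset.range i, F j)⟩)
      ?_ ?_ ?_ ?_))
    · simp [NatExp.eval, RealExp.eval]
    · rintro i s' rfl
      exact hb i _
    · rintro i - s' - rfl
      refine Wp.setCell ?_
      simp [NatExp.eval, RealExp.eval, hr, Finset.sum_range_succ]
    · exact fun s' _ h => h
  obtain ⟨s', h1, rfl⟩ := h
  exact h1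

/-- Search for the first value of the register `v` at which `t` fails. -/
def searchProg (v : ℕ) (t : Test Q) : Prog Q :=
  .seq (.setVar v (.const 0)) (.loop t (.setVar v (.add (.var v) (.const 1))))

theorem exec_searchProg {v : ℕ} {t : Test Q} {s : Store} {N : ℕ}
    (hN : ¬ t.holds O ⟨Function.update s.var v N, s.mem⟩)
    (hlt : ∀ i < N, t.holds O ⟨Function.update s.var v i, s.mem⟩) :
    Exec O (searchProg v t) s ⟨Function.update s.var v N, s.mem⟩ := by
  have key : ∀ k i, i + k = N → Exec O (.loop t (.setVar v (.add (.var v) (.const 1))))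
      ⟨Function.update s.var v i, s.mem⟩ ⟨Function.update s.var v N, s.mem⟩ := by
    intro k
    induction k with
    | zero =>
      intro i hi
      obtain rfl : i = N := hi
      exact .loopStop hN
    | succ k ih =>
      intro i hi
      refine .loopStep (hlt i (by omega)) ?_ (ih (i + 1) (by omega))
      have h := Exec.setVar (O := O) v (.add (.var v) (.const 1))
        ⟨Function.update s.var v i, s.mem⟩
      simpa [NatExp.eval] using h
  exact .seq (.setVar v (.const 0) s) (key N 0 (by omega))

end Wp

/-! ### The search for the best candidate

Register `0` holds the stage `n`, register `1` the accuracy `k`, register `2` the code `m` of the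
current candidate and register `3` the code of the best one. The expressions are parametrized by
an embedding `qu` of the queries about `(T, x, z)` into those of the machine. -/

section Search

variable {Q : Type}

/-- The expression for `digit n m i`. -/
def digitExp (i : NatExp) : NatExp :=
  .mod (.div (.var 2) (.add (.var 0) (.const 1)))
    (.add (.mul (.add i (.const 1)) (.mod (.var 2) (.add (.var 0) (.const 1)))) (.const 1))

/-- The expression for `cutoff n m j`. -/
def cutoffExp (j : NatExp) : NatExp :=
  .sub (.const 1) (.sub (.const 1) (.sub (digitExp (.const 1)) j))

/-- The (nonnegative) part of a numerator coded at position `4 j + r`. -/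
def partExp (j : NatExp) (r : ℕ) : RealExp Q :=
  .ofNat (.mul (cutoffExp j) (digitExp (.add (.mul (.const 4) j) (.const r))))

/-- The expression for `reNum n m j`. -/
def reNumExp (j : NatExp) : RealExp Q := .sub (partExp j 2) (partExp j 3)

/-- The expression for `imNum n m j`. -/
def imNumExp (j : NatExp) : RealExp Q := .sub (partExp j 4) (partExp j 5)

/-- The expression for `denom n m`. -/
def denomExp : RealExp Q := .ofNat (.add (digitExp (.const 0)) (.const 1))

/-- The entry `δ_{ij}` of the identity matrix, by truncated subtraction. -/
def deltaExp (i j : NatExp) : NatExp := .sub (.const 1) (.add (.sub i j) (.sub j i))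

theorem eval_reNumExp (O : Oracle Q) (s : Store) (j : NatExp) :
    (reNumExp j : RealExp Q).eval O s = reNum (s.var 0) (s.var 2) (j.eval O s) := by
  simp [reNumExp, partExp, RealExp.eval, NatExp.eval, cutoffExp, digitExp, reNum, cutoff, digit]

theorem eval_imNumExp (O : Oracle Q) (s : Store) (j : NatExp) :
    (imNumExp j : RealExp Q).eval O s = imNum (s.var 0) (s.var 2) (j.eval O s) := by
  simp [imNumExp, partExp, RealExp.eval, NatExp.eval, cutoffExp, digitExp, imNum, cutoff, digit]

theorem eval_denomExp (O : Oracle Q) (s : Store) :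
    (denomExp : RealExp Q).eval O s = denom (s.var 0) (s.var 2) := by
  simp [denomExp, RealExp.eval, NatExp.eval, digitExp, denom, digit]

theorem eval_deltaExp (O : Oracle Q) (s : Store) (i j : NatExp) :
    ((deltaExp i j).eval O s : ℝ) = if i.eval O s = j.eval O s then 1 else 0 := by
  have h : (deltaExp i j).eval O s = if i.eval O s = j.eval O s then 1 else 0 := by
    simp only [deltaExp, NatExp.eval]
    split_ifs <;> omega
  rw [h]
  split_ifs <;> simp

variable (qu : EntryQuery → Q)

/-- Real part of the matrix entry `⟨(T - z) e_j, e_i⟩`. -/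
def reEntryExp (i j : NatExp) : RealExp Q :=
  .sub (.query (qu .reT) i j)
    (.mul (.query (qu .reZ) (.const 0) (.const 0)) (.ofNat (deltaExp i j)))

/-- Imaginary part of the matrix entry `⟨(T - z) e_j, e_i⟩`. -/
def imEntryExp (i j : NatExp) : RealExp Q :=
  .sub (.query (qu .imT) i j)
    (.mul (.query (qu .imZ) (.const 0) (.const 0)) (.ofNat (deltaExp i j)))

/-- Summand `j` (register `5`) in the real part of row `i` (register `4`) of `(T - z) Y`, where
`Y` is the vector of numerators of the candidate. -/
def reRowExp : RealExp Q :=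
  .sub (.mul (reEntryExp qu (.var 4) (.var 5)) (reNumExp (.var 5)))
    (.mul (imEntryExp qu (.var 4) (.var 5)) (imNumExp (.var 5)))

/-- The imaginary analogue of `reRowExp`. -/
def imRowExp : RealExp Q :=
  .add (.mul (reEntryExp qu (.var 4) (.var 5)) (imNumExp (.var 5)))
    (.mul (imEntryExp qu (.var 4) (.var 5)) (reNumExp (.var 5)))

/-- Real part of row `i` of `(T - z) Y - D x`, with `D` the denominator of the candidate. -/
def reResExp : RealExp Q :=
  .sub (.cell (.const 1)) (.mul denomExp (.query (qu .reX) (.var 4) (.const 0)))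

/-- The imaginary analogue of `reResExp`; the cells `1` and `2` hold the two parts of the row. -/
def imResExp : RealExp Q :=
  .sub (.cell (.const 2)) (.mul denomExp (.query (qu .imX) (.var 4) (.const 0)))

/-- Compute the squared residual of the candidate coded by register `2` in the cell `0`. -/
def residualProg : Prog Q :=
  .seq (.setCell (.const 0) (.ofNat (.const 0))) <|
  .seq (forLoop 4 (.ask (.var 0)) <|
    .seq (sumProg 1 5 (.var 0) (reRowExp qu)) <|
    .seq (sumProg 2 5 (.var 0) (imRowExp qu)) <|
    .setCell (.const 0) (.add (.cell (.const 0))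
      (.add (.mul (reResExp qu) (reResExp qu)) (.mul (imResExp qu) (imResExp qu)))))
  (.setDiv (.const 0) (.cell (.const 0)) (.mul denomExp denomExp))

/-- Go through the candidates `0, …, (n + 1)²`, and leave the best code in the register `3` and its
squared residual in the cell `3`. -/
def bestProg : Prog Q :=
  .seq (.setVar 2 (.const 0)) <|
  .seq (residualProg qu) <|
  .seq (.setVar 3 (.const 0)) <|
  .seq (.setCell (.const 3) (.cell (.const 0))) <|
  forLoop 6 (.mul (.add (.var 0) (.const 1)) (.add (.var 0) (.const 1))) <|
    .seq (.setVar 2 (.add (.var 6) (.const 1))) <|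
    .seq (residualProg qu) <|
    .branch (.realLt (.cell (.const 0)) (.cell (.const 3)))
      (.seq (.setVar 3 (.var 2)) (.setCell (.const 3) (.cell (.const 0))))
      .skip

/-- The oracle `O` answers the queries `qu` about `(T, x, z)` and knows `f`. -/
structure Answers (O : Oracle Q) (f : ℕ → ℕ) (T : Hsp →ₗ.[ℂ] Hsp) (x : Hsp) (z : ℂ) : Prop where
  index : O.index = f
  value : ∀ q i j, O.value (qu q) i j = entryValue T x z q i j

/-- Real part of the entry `(i, j)` of the matrix of `T - z`. -/
noncomputable def reEntry (T : Hsp →ₗ.[ℂ] Hsp) (z : ℂ) (i j : ℕ) : ℝ :=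
  ((app T (e j) : ℕ → ℂ) i).re - z.re * if i = j then 1 else 0

/-- Imaginary part of the entry `(i, j)` of the matrix of `T - z`. -/
noncomputable def imEntry (T : Hsp →ₗ.[ℂ] Hsp) (z : ℂ) (i j : ℕ) : ℝ :=
  ((app T (e j) : ℕ → ℂ) i).im - z.im * if i = j then 1 else 0

/-- Real part of row `i` of `(T - z) Y`, with `Y` the vector of numerators of the candidate. -/
noncomputable def reRow (T : Hsp →ₗ.[ℂ] Hsp) (z : ℂ) (n m i : ℕ) : ℝ :=
  ∑ j ∈ Finset.range n, (reEntry T z i j * reNum n m j - imEntry T z i j * imNum n m j)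

/-- Imaginary part of row `i` of `(T - z) Y`. -/
noncomputable def imRow (T : Hsp →ₗ.[ℂ] Hsp) (z : ℂ) (n m i : ℕ) : ℝ :=
  ∑ j ∈ Finset.range n, (reEntry T z i j * imNum n m j + imEntry T z i j * reNum n m j)

/-- The squared modulus of row `i` of `(T - z) Y - D x`. -/
noncomputable def rowSq (T : Hsp →ₗ.[ℂ] Hsp) (x : Hsp) (z : ℂ) (n m i : ℕ) : ℝ :=
  (reRow T z n m i - denom n m * ((x : ℕ → ℂ) i).re) *
      (reRow T z n m i - denom n m * ((x : ℕ → ℂ) i).re) +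
    (imRow T z n m i - denom n m * ((x : ℕ → ℂ) i).im) *
      (imRow T z n m i - denom n m * ((x : ℕ → ℂ) i).im)

theorem e_coord (j i : ℕ) : (e j : ℕ → ℂ) i = if i = j then 1 else 0 := by
  simp [e, Pi.single_apply]

/-- The squared residual as a finite expression in the numbers that can be queried. -/
theorem residualSq_eq {T : Hsp →ₗ.[ℂ] Hsp} (hT : IsAdmissible T) (f : ℕ → ℕ) (x : Hsp) (z : ℂ)
    (n m : ℕ) : residualSq f T x z n m =
      (∑ i ∈ Finset.range (f n), rowSq T x z n m i) / (denom n m * denom n m) := by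
  have hD := (denom_pos n m).ne'
  rw [residualSq, ← map_sub, norm_sq_P, Finset.sum_div]
  refine Finset.sum_congr rfl fun i _ => ?_
  have h1 : ((app T (candidate n m) - z • candidate n m - x : Hsp) : ℕ → ℂ) i =
      (⟨(reRow T z n m i - denom n m * ((x : ℕ → ℂ) i).re) / denom n m,
        (imRow T z n m i - denom n m * ((x : ℕ → ℂ) i).im) / denom n m⟩ : ℂ) := by
    rw [candidate, app_sum_smul_e hT, Finset.smul_sum, ← Finset.sum_sub_distrib, ← inner_e,
      inner_sub_right, inner_sum]
    simp only [inner_sub_right, inner_smul_right, inner_e, e_coord]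
    apply Complex.ext
    · simp only [Complex.sub_re, Complex.re_sum, reRow]
      rw [sub_div, mul_div_cancel_left₀ _ hD, Finset.sum_div]
      congr 1
      refine Finset.sum_congr rfl fun j _ => ?_
      simp only [reEntry, imEntry]
      split_ifs <;> simp <;> ring
    · simp only [Complex.sub_im, Complex.im_sum, imRow]
      rw [sub_div, mul_div_cancel_left₀ _ hD, Finset.sum_div]
      congr 1
      refine Finset.sum_congr rfl fun j _ => ?_
      simp only [reEntry, imEntry]
      split_ifs <;> simp <;> ring
  rw [h1, Complex.sq_norm, Complex.normSq_mk, rowSq]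
  field_simp

variable {qu} {O : Oracle Q} {f : ℕ → ℕ} {T : Hsp →ₗ.[ℂ] Hsp} {x : Hsp} {z : ℂ}

section
variable (hO : Answers qu O f T x z)
include hO

theorem eval_reRowExp (s : Store) : (reRowExp qu).eval O s =
    reEntry T z (s.var 4) (s.var 5) * reNum (s.var 0) (s.var 2) (s.var 5) -
      imEntry T z (s.var 4) (s.var 5) * imNum (s.var 0) (s.var 2) (s.var 5) := by
  simp only [reRowExp, RealExp.eval, eval_reNumExp, eval_imNumExp, reEntryExp, imEntryExp, hO.value,
    entryValue, eval_deltaExp, inner_e, reEntry, imEntry, NatExp.eval]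
  rfl

theorem eval_imRowExp (s : Store) : (imRowExp qu).eval O s =
    reEntry T z (s.var 4) (s.var 5) * imNum (s.var 0) (s.var 2) (s.var 5) +
      imEntry T z (s.var 4) (s.var 5) * reNum (s.var 0) (s.var 2) (s.var 5) := by
  simp only [imRowExp, RealExp.eval, eval_reNumExp, eval_imNumExp, reEntryExp, imEntryExp, hO.value,
    entryValue, eval_deltaExp, inner_e, reEntry, imEntry, NatExp.eval]
  rfl

theorem eval_reResExp (s : Store) : (reResExp qu).eval O s =
    s.mem 1 - denom (s.var 0) (s.var 2) * ((x : ℕ → ℂ) (s.var 4)).re := by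
  simp [reResExp, RealExp.eval, eval_denomExp, hO.value, entryValue, inner_e, NatExp.eval]

theorem eval_imResExp (s : Store) : (imResExp qu).eval O s =
    s.mem 2 - denom (s.var 0) (s.var 2) * ((x : ℕ → ℂ) (s.var 4)).im := by
  simp [imResExp, RealExp.eval, eval_denomExp, hO.value, entryValue, inner_e, NatExp.eval]

/-- `residualProg` uses the registers `4`, `5` and the cells `0`, `1`, `2` only. -/
theorem wp_residualProg (hT : IsAdmissible T) (s : Store) :
    Wp O (residualProg qu) s fun s' =>
      s'.mem 0 = residualSq f T x z (s.var 0) (s.var 2) ∧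
      (∀ v, v ≠ 4 → v ≠ 5 → s'.var v = s.var v) ∧ (∀ a, 3 ≤ a → s'.mem a = s.mem a) := by
  set n := s.var 0 with hn
  set m := s.var 2 with hm
  refine Wp.seq (Wp.setCell (Wp.seq (Wp.forLoop (f n) (fun i s' =>
    s'.mem 0 = ∑ j ∈ Finset.range i, rowSq T x z n m j ∧
      (∀ v, v ≠ 4 → v ≠ 5 → s'.var v = s.var v) ∧ (∀ a, 3 ≤ a → s'.mem a = s.mem a))
    ?_ ?_ ?_ ?_)))
  · refine ⟨by simp [NatExp.eval, RealExp.eval], fun v h4 _ => ?_, fun a ha => ?_⟩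
    · simp [h4]
    · have : a ≠ 0 := by omega
      simp [NatExp.eval, this]
  · rintro i s' ⟨-, h, -⟩
    simp [NatExp.eval, hO.index, h, hn]
  · rintro i hi s' hv ⟨h1, h2, h3⟩
    have e0 : s'.var 0 = n := h2 0 (by decide) (by decide)
    have e2 : s'.var 2 = m := h2 2 (by decide) (by decide)
    refine Wp.seq (Wp.of_exec (exec_sumProg n
      (fun j => reEntry T z i j * reNum n m j - imEntry T z i j * imNum n m j) ?_ ?_) ?_)
    · intro j t; simp [NatExp.eval, e0]
    · intro j t; simp [eval_reRowExp hO, e0, e2, hv]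
    refine Wp.seq (Wp.of_exec (exec_sumProg n
      (fun j => reEntry T z i j * imNum n m j + imEntry T z i j * reNum n m j) ?_ ?_) ?_)
    · intro j t; simp [NatExp.eval, e0]
    · intro j t; simp [eval_imRowExp hO, e0, e2, hv]
    refine Wp.setCell ⟨by simp [hv], ?_, fun v h4 h5 => ?_, fun a ha => ?_⟩
    · simp [RealExp.eval, NatExp.eval, eval_reResExp hO, eval_imResExp hO, e0, e2, hv, h1,
        Finset.sum_range_succ, rowSq, reRow, imRow]
    · simp [h4, h5, h2]
    · have h0' : a ≠ 0 := by omega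
      have h1' : a ≠ 1 := by omega
      have h2' : a ≠ 2 := by omega
      simp [NatExp.eval, h0', h1', h2', h3 a ha]
  · rintro s' - ⟨h1, h2, h3⟩
    have e0 : s'.var 0 = n := h2 0 (by decide) (by decide)
    have e2 : s'.var 2 = m := h2 2 (by decide) (by decide)
    have hD := (denom_pos n m).ne'
    refine Wp.setDiv (by simp [RealExp.eval, eval_denomExp, e0, e2, hD]) ⟨?_, h2, fun a ha => ?_⟩
    · simp [RealExp.eval, NatExp.eval, eval_denomExp, e0, e2, h1, residualSq_eq hT]
    · have : a ≠ 0 := by omega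
      simp [NatExp.eval, this, h3 a ha]

theorem wp_bestProg (hT : IsAdmissible T) (s : Store) :
    Wp O (bestProg qu) s fun s' =>
      s'.var 0 = s.var 0 ∧ s'.var 1 = s.var 1 ∧ s'.var 3 = bestCode f T x z (s.var 0) ∧
      s'.mem 3 = residualSq f T x z (s.var 0) (bestCode f T x z (s.var 0)) := by
  set n := s.var 0 with hn
  set g := residualSq f T x z n with hg
  refine Wp.seq (Wp.setVar (Wp.seq ((wp_residualProg hO hT _).mono ?_)))
  rintro s₁ ⟨h1, h2, -⟩
  have e0 : s₁.var 0 = n := by rw [h2 0 (by decide) (by decide)]; simp [hn]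
  have e1 : s₁.var 1 = s.var 1 := by rw [h2 1 (by decide) (by decide)]; simp
  refine Wp.seq (Wp.setVar (Wp.seq (Wp.setCell (Wp.forLoop ((n + 1) * (n + 1)) (fun i s' =>
    s'.var 0 = n ∧ s'.var 1 = s.var 1 ∧ s'.var 3 = bestIndex g i ∧ s'.mem 3 = g (bestIndex g i))
    ?_ ?_ ?_ ?_))))
  · simp [NatExp.eval, RealExp.eval, bestIndex, e0, e1, h1, ← hn, hg]
  · rintro i s' ⟨h, -⟩
    simp [NatExp.eval, h]
  · rintro i - s' hv ⟨h3, h4, h5, h6⟩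
    refine Wp.seq (Wp.setVar (Wp.seq ((wp_residualProg hO hT _).mono ?_)))
    rintro s₂ ⟨k1, k2, k3⟩
    have f0 : s₂.var 0 = n := by rw [k2 0 (by decide) (by decide)]; simp [h3]
    have f1 : s₂.var 1 = s.var 1 := by rw [k2 1 (by decide) (by decide)]; simp [h4]
    have f2 : s₂.var 2 = i + 1 := by
      rw [k2 2 (by decide) (by decide)]; simp [NatExp.eval, hv]
    have f3 : s₂.var 3 = bestIndex g i := by rw [k2 3 (by decide) (by decide)]; simp [h5]
    have f6 : s₂.var 6 = i := by rw [k2 6 (by decide) (by decide)]; simp [hv]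
    have m3 : s₂.mem 3 = g (bestIndex g i) := by rw [k3 3 le_rfl, h6]
    have m0 : s₂.mem 0 = g (i + 1) := by rw [k1]; simp [NatExp.eval, hv, h3, hg]
    by_cases hlt : g (i + 1) < g (bestIndex g i)
    · have hb : bestIndex g (i + 1) = i + 1 := by rw [bestIndex, if_pos hlt]
      refine Wp.of_exec (.branchTrue ?_ (.seq (.setVar ..) (.setCell ..))) ?_
      · simpa [Test.holds, RealExp.eval, NatExp.eval, m0, m3] using hlt
      · simp [NatExp.eval, RealExp.eval, f0, f1, f2, f6, m0, hb]
    · have hb : bestIndex g (i + 1) = bestIndex g i := by rw [bestIndex, if_neg hlt]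
      refine Wp.of_exec (.branchFalse ?_ (.skip _)) ?_
      · simpa [Test.holds, RealExp.eval, NatExp.eval, m0, m3] using hlt
      · simp [f0, f1, f3, f6, m3, hb]
  · exact fun s' _ h => h

end

end Search

/-! ### The algorithm for the resolvent -/

/-- Find the best candidate and write its coefficients to the output cells. -/
def resolventProg : Prog EntryQuery :=
  .seq (bestProg id) <|
  .seq (.setVar 2 (.var 3)) <|
  forLoop 4 (.var 0) <|
    .seq (.setDiv (.mul (.const 2) (.var 4)) (reNumExp (.var 4)) denomExp) <|
    .setDiv (.add (.mul (.const 2) (.var 4)) (.const 1)) (imNumExp (.var 4)) denomExp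

theorem computesVector_resolventProg {T : Hsp →ₗ.[ℂ] Hsp} (hT : IsAdmissible T) (f : ℕ → ℕ)
    (x : Hsp) (z : ℂ) (n : ℕ) :
    ComputesVector resolventProg (entryOracle f T x z) n (candidate n (bestCode f T x z n)) := by
  have hO : Answers id (entryOracle f T x z) f T x z := ⟨rfl, fun _ _ _ => rfl⟩
  set m := bestCode f T x z n with hm
  have hD := (denom_pos n m).ne'
  have h : Wp (entryOracle f T x z) resolventProg (initStore n 0) fun s =>
      outVector s = candidate n m := by
    refine Wp.seq ((wp_bestProg hO hT _).mono ?_)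
    rintro s ⟨h0, -, h3, -⟩
    have h0 : s.var 0 = n := h0
    have h3 : s.var 3 = m := h3
    refine Wp.seq (Wp.setVar (Wp.forLoop n (fun i s' => s'.var 0 = n ∧ s'.var 2 = m ∧
      ∀ j < i, s'.mem (2 * j) = reNum n m j / denom n m ∧
        s'.mem (2 * j + 1) = imNum n m j / denom n m) ?_ ?_ ?_ ?_))
    · simp [NatExp.eval, h0, h3]
    · rintro i s' ⟨h, -⟩
      exact h
    · rintro i - s' hv ⟨k0, k2, k⟩
      refine Wp.seq (Wp.setDiv (by simp [eval_denomExp, k0, k2, hD])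
        (Wp.setDiv (by simp [eval_denomExp, k0, k2, hD]) ⟨hv, ?_, ?_, ?_⟩))
      · simp [k0]
      · simp [k2]
      · intro j hj
        simp only [eval_reNumExp, eval_imNumExp, eval_denomExp, NatExp.eval, k0, k2, hv]
        rcases Nat.lt_succ_iff_lt_or_eq.1 hj with hj | rfl
        · obtain ⟨ka, kb⟩ := k j hj
          rw [Function.update_of_ne (by omega), Function.update_of_ne (by omega),
            Function.update_of_ne (by omega), Function.update_of_ne (by omega)]
          exact ⟨ka, kb⟩
        · rw [Function.update_of_ne (by omega), Function.update_self, Function.update_self]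
          exact ⟨rfl, rfl⟩
    · rintro s' - ⟨k0, -, k⟩
      rw [outVector, candidate, k0]
      refine Finset.sum_congr rfl fun j hj => ?_
      obtain ⟨ka, kb⟩ := k j (Finset.mem_range.1 hj)
      rw [ka, kb]
  exact h

/-! ### The algorithm for the error bound -/

/-- Compute `E_n / d` with accuracy `2⁻ᵏ` as `(C₂ β_{f(n)} + C₁ α_n s / N + t / N) / d`, where
`s = ⌊N √A⌋` and `t = ⌊N √B⌋` for the squared norm `A` of the best candidate and its squared
residual `B`, and `N d ≥ 2ᵏ (C₁ α_n + 1)`. The registers `5`, `7`, `8` hold `N`, `s`, `t`, and the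
cells `3`, `4`, `5` hold `B`, `A`, `2ᵏ`. -/
def boundProg : Prog BoundQuery :=
  .seq (bestProg .entry) <|
  .seq (.setVar 2 (.var 3)) <|
  .seq (sumProg 4 4 (.var 0) (.add (.mul (reNumExp (.var 4)) (reNumExp (.var 4)))
    (.mul (imNumExp (.var 4)) (imNumExp (.var 4))))) <|
  .seq (.setDiv (.const 4) (.cell (.const 4)) (.mul denomExp denomExp)) <|
  .seq (.setCell (.const 5) (.ofNat (.const 1))) <|
  .seq (forLoop 4 (.var 1)
    (.setCell (.const 5) (.add (.cell (.const 5)) (.cell (.const 5))))) <|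
  .seq (searchProg 5 (.realLt (.mul (.ofNat (.var 5)) (.query .dist (.const 0) (.const 0)))
    (.mul (.cell (.const 5)) (.add (.mul (.query .const₁ (.const 0) (.const 0))
      (.query .alpha (.var 0) (.const 0))) (.ofNat (.const 1)))))) <|
  .seq (searchProg 7 (.neg (.realLt (.mul (.ofNat (.mul (.var 5) (.var 5))) (.cell (.const 4)))
    (.ofNat (.mul (.add (.var 7) (.const 1)) (.add (.var 7) (.const 1))))))) <|
  .seq (searchProg 8 (.neg (.realLt (.mul (.ofNat (.mul (.var 5) (.var 5))) (.cell (.const 3)))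
    (.ofNat (.mul (.add (.var 8) (.const 1)) (.add (.var 8) (.const 1))))))) <|
  .setDiv (.const 0)
    (.add (.add (.mul (.mul (.query .const₂ (.const 0) (.const 0))
          (.query .beta (.ask (.var 0)) (.const 0))) (.ofNat (.var 5)))
        (.mul (.mul (.query .const₁ (.const 0) (.const 0)) (.query .alpha (.var 0) (.const 0)))
          (.ofNat (.var 7))))
      (.ofNat (.var 8)))
    (.mul (.ofNat (.var 5)) (.query .dist (.const 0) (.const 0)))

theorem norm_sq_candidate (n m : ℕ) : ‖candidate n m‖ ^ 2 =
    (∑ j ∈ Finset.range n, (reNum n m j * reNum n m j + imNum n m j * imNum n m j)) /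
      (denom n m * denom n m) := by
  have hD := (denom_pos n m).ne'
  rw [candidate, norm_sq_sum_smul_e, Finset.sum_div]
  refine Finset.sum_congr rfl fun j _ => ?_
  rw [Complex.sq_norm, Complex.normSq_mk]
  field_simp

/-- The integer `⌊N a⌋` is the first `s` with `N² a² < (s + 1)²`, so that it can be found from the
square of `a`. -/
theorem exists_least_sq {a : ℝ} (ha : 0 ≤ a) (N : ℕ) :
    ∃ s : ℕ, ((N * N : ℕ) : ℝ) * a ^ 2 < (((s + 1) * (s + 1) : ℕ) : ℝ) ∧
      (∀ i < s, ¬ ((N * N : ℕ) : ℝ) * a ^ 2 < (((i + 1) * (i + 1) : ℕ) : ℝ)) ∧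
      |(s : ℝ) - N * a| ≤ 1 := by
  have hNa : (0 : ℝ) ≤ N * a := by positivity
  refine ⟨⌊N * a⌋₊, ?_, ?_, ?_⟩
  · have h := Nat.lt_floor_add_one ((N : ℝ) * a)
    push_cast
    nlinarith
  · intro i hi
    have h1 : ((i + 1 : ℕ) : ℝ) ≤ N * a := (Nat.le_floor_iff hNa).1 hi
    push_cast at h1 ⊢
    nlinarith
  · have h1 := Nat.lt_floor_add_one ((N : ℝ) * a)
    have h2 := Nat.floor_le hNa
    rw [abs_le]
    constructor <;> linarith

/-- The first `N` with `c ≤ N d` is `⌈c / d⌉`. -/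
theorem exists_least_mul {d c : ℝ} (hd : 0 < d) :
    ∃ N : ℕ, ¬ (N : ℝ) * d < c ∧ ∀ i < N, (i : ℝ) * d < c := by
  refine ⟨⌈c / d⌉₊, ?_, fun i hi => ?_⟩
  · rw [not_lt, ← div_le_iff₀ hd]
    exact Nat.le_ceil _
  · rw [← lt_div_iff₀ hd]
    exact Nat.lt_ceil.1 hi

theorem computesReal_boundProg {T : Hsp →ₗ.[ℂ] Hsp} (hT : IsAdmissible T) (f : ℕ → ℕ)
    (α β : ℕ → ℝ) (hα : ∀ n, 0 ≤ α n) (x : Hsp) (z : ℂ) {C₁ C₂ d : ℝ} (hC₁ : 0 ≤ C₁) (hd : 0 < d)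
    (n k : ℕ) :
    ∃ b : ℝ, ComputesReal boundProg (boundOracle f α β T x z C₁ C₂ d) n k b ∧
      |b - errNumerator f α β T x z C₁ C₂ n (candidate n (bestCode f T x z n)) / d| ≤
        (2 ^ k)⁻¹ := by
  have hO : Answers .entry (boundOracle f α β T x z C₁ C₂ d) f T x z := ⟨rfl, fun _ _ _ => rfl⟩
  set m := bestCode f T x z n with hm
  have hD := (denom_pos n m).ne'
  set a := ‖candidate n m‖ with ha
  set r := ‖P (f n) (app T (candidate n m) - z • candidate n m) - P (f n) x‖ with hr
  have hres : residualSq f T x z n m = r ^ 2 := rfl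
  have hcα : 0 ≤ C₁ * α n := mul_nonneg hC₁ (hα n)
  obtain ⟨N, hN, hN'⟩ := exists_least_mul (c := 2 ^ k * (C₁ * α n + 1)) hd
  obtain ⟨s, hs, hs', hsa⟩ := exists_least_sq (norm_nonneg (candidate n m)) N
  obtain ⟨t, ht, ht', htr⟩ := exists_least_sq (norm_nonneg
    (P (f n) (app T (candidate n m) - z • candidate n m) - P (f n) x)) N
  rw [← ha] at hs hs' hsa
  rw [← hr] at ht ht' htr
  have hNd : 2 ^ k * (C₁ * α n + 1) ≤ N * d := not_lt.1 hN
  have hNd0 : (0 : ℝ) < N * d := lt_of_lt_of_le (by positivity) hNd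
  have hN0 : (N : ℝ) ≠ 0 := fun h => by simp [h] at hNd0
  refine ⟨(C₂ * β (f n) * N + C₁ * α n * s + t) / (N * d), ?_, ?_⟩
  · have h : Wp (boundOracle f α β T x z C₁ C₂ d) boundProg (initStore n k) fun s' =>
        s'.mem 0 = (C₂ * β (f n) * N + C₁ * α n * s + t) / (N * d) := by
      refine Wp.seq ((wp_bestProg hO hT _).mono ?_)
      rintro s₁ ⟨h0, h1, h3, m3⟩
      have h0 : s₁.var 0 = n := h0
      have h1 : s₁.var 1 = k := h1
      have h3 : s₁.var 3 = m := h3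
      have m3 : s₁.mem 3 = r ^ 2 := m3
      refine Wp.seq (Wp.setVar (Wp.seq (Wp.of_exec (exec_sumProg n
        (fun j => reNum n m j * reNum n m j + imNum n m j * imNum n m j) ?_ ?_) ?_)))
      · intro j t; simp [NatExp.eval, h0]
      · intro j t; simp [RealExp.eval, eval_reNumExp, eval_imNumExp, NatExp.eval, h0, h3]
      refine Wp.seq (Wp.setDiv ?_ ?_)
      · simp [RealExp.eval, eval_denomExp, NatExp.eval, h0, h3, hD]
      refine Wp.seq (Wp.setCell (Wp.seq (Wp.forLoop k (fun i s' => s'.var 0 = n ∧ s'.var 1 = k ∧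
        s'.mem 3 = r ^ 2 ∧ s'.mem 4 = a ^ 2 ∧ s'.mem 5 = 2 ^ i) ?_ ?_ ?_ ?_)))
      · simp [RealExp.eval, eval_denomExp, NatExp.eval, h0, h1, h3, m3, ha, norm_sq_candidate]
      · rintro i s' ⟨-, h, -⟩
        exact h
      · rintro i - s' hv ⟨k0, k1, l3, l4, l5⟩
        refine Wp.setCell ⟨hv, ?_⟩
        simp [RealExp.eval, NatExp.eval, k0, k1, l3, l4, l5, pow_succ, mul_two]
      rintro s₂ - ⟨k0, k1, l3, l4, l5⟩
      refine Wp.seq (Wp.of_exec (exec_searchProg (N := N) ?_ ?_) ?_)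
      · simpa [Test.holds, RealExp.eval, NatExp.eval, boundOracle, k0, l5] using hN
      · simpa [Test.holds, RealExp.eval, NatExp.eval, boundOracle, k0, l5] using hN'
      refine Wp.seq (Wp.of_exec (exec_searchProg (N := s) ?_ ?_) ?_)
      · simpa [Test.holds, RealExp.eval, NatExp.eval, l4] using hs
      · simpa [Test.holds, RealExp.eval, NatExp.eval, l4] using hs'
      refine Wp.seq (Wp.of_exec (exec_searchProg (N := t) ?_ ?_) ?_)
      · simpa [Test.holds, RealExp.eval, NatExp.eval, l3] using ht
      · simpa [Test.holds, RealExp.eval, NatExp.eval, l3] using ht'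
      refine Wp.setDiv ?_ ?_
      · simpa [RealExp.eval, NatExp.eval, boundOracle] using hNd0.ne'
      · simp [RealExp.eval, NatExp.eval, boundOracle, k0]
    exact h
  · have hE : errNumerator f α β T x z C₁ C₂ n (candidate n m) =
        C₂ * β (f n) + C₁ * α n * a + r := rfl
    have hdiff : (C₂ * β (f n) * N + C₁ * α n * s + t) / (N * d) -
        (C₂ * β (f n) + C₁ * α n * a + r) / d =
        (C₁ * α n * (s - N * a) + (t - N * r)) / (N * d) := by
      field_simp
      ring
    rw [hE, hdiff, abs_div, abs_of_pos hNd0, div_le_iff₀ hNd0]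
    calc |C₁ * α n * (s - N * a) + (t - N * r)|
        ≤ |C₁ * α n * (s - N * a)| + |t - N * r| := abs_add_le _ _
      _ ≤ C₁ * α n * 1 + 1 := by
        rw [abs_mul, abs_of_nonneg hcα]
        gcongr
      _ = (2 ^ k)⁻¹ * (2 ^ k * (C₁ * α n + 1)) := by field_simp
      _ ≤ (2 ^ k)⁻¹ * (N * d) := by gcongr

end ResolventSCI

theorem theorem2p1 :
    -- one pair of programs serves all `f`, `α`, `β`
    ∃ (p : Prog EntryQuery) (q : Prog BoundQuery),
      ∀ (f : ℕ → ℕ) (α β : ℕ → ℝ),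
        (∀ n, 1 ≤ n → n < f n) →
        (∀ n, 0 ≤ α n) → (∀ n, 0 ≤ β n) →
        Tendsto α atTop (𝓝 0) → Tendsto β atTop (𝓝 0) →
        ∃ Γ : ℕ → (Hsp →ₗ.[ℂ] Hsp) → Hsp → ℂ → Hsp,
          ∀ (T : Hsp →ₗ.[ℂ] Hsp) (x : Hsp) (z : ℂ),
            (T, x) ∈ decayClass f α β → z ∉ specT T →
            -- `Γ n` is computed by the program `p`
            (∀ n, 1 ≤ n → ComputesVector p (entryOracle f T x z) n (Γ n T x z)) ∧
            -- its values are finitely supported, in particular in the domain of `T`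
            (∀ n, 1 ≤ n → {i : ℕ | (Γ n T x z : ℕ → ℂ) i ≠ 0}.Finite ∧ Γ n T x z ∈ T.domain) ∧
            -- convergence
            Tendsto (fun n => Γ n T x z) atTop (𝓝 (resolv z T x)) ∧
            ∀ C₁ C₂ : ℝ, 0 ≤ C₁ → 0 ≤ C₂ →
              -- the error bound
              (∀ n, 1 ≤ n →
                ‖(1 - P (f n)) ∘L truncation T n‖ ≤ C₁ * α n →
                ‖P (f n) x - x‖ ≤ C₂ * β (f n) →
                ‖Γ n T x z - resolv z T x‖ ≤
                  errNumerator f α β T x z C₁ C₂ n (Γ n T x z) / Metric.infDist z (specT T)) ∧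
              -- its computation to any accuracy `2⁻ᵏ`
              (∀ d : ℝ, 0 < d → ∀ n, 1 ≤ n → ∀ k : ℕ, ∃ b : ℝ,
                ComputesReal q (boundOracle f α β T x z C₁ C₂ d) n k b ∧
                |b - errNumerator f α β T x z C₁ C₂ n (Γ n T x z) / d| ≤ (2 ^ k)⁻¹) := by
  refine ⟨resolventProg, boundProg, fun f α β hf hα _ hα0 hβ0 =>
    ⟨fun n T x z => candidate n (bestCode f T x z n), fun T x z hTx hz => ?_⟩⟩
  have hT : IsNormalOp T := hTx.1
  have hA : IsAdmissible T := hT.toIsAdmissible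
  have hR := resolv_spec hz
  refine ⟨fun n _ => computesVector_resolventProg hA f x z n, fun n _ => ⟨?_, candidate_mem hA _ _⟩,
    tendsto_of_residual hf hα0 hβ0 hTx hR (fun n => P_candidate _ _)
      (tendsto_residual_bestCode hA hR f x), fun C₁ C₂ hC₁ _ => ⟨fun n hn h1 h2 => ?_,
      fun d hd n _ k => computesReal_boundProg hA f α β hα x z hC₁ hd n k⟩⟩
  · exact finite_support_candidate n _
  · obtain ⟨hpos, hnorm⟩ := hT.norm_resolvent_le hR
    refine (hA.norm_sub_resolvent_le hR (hf n hn).le (P_candidate n _) x).trans ?_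
    rw [errNumerator, div_eq_mul_one_div, mul_comm]
    refine mul_le_mul (by gcongr) hnorm (norm_nonneg _) ?_
    have hα1 := (norm_nonneg _).trans h1
    have hβ1 := (norm_nonneg _).trans h2
    positivity
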